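/- For a simple labelled graph on $[n]=\{1,\dots,n\}$ put $Y_{ij}=Y_{ji}=1$ if $\{i,j\}$ is an edge and $Y_{ij}=Y_{ji}=-1$ if it is not ($i\ne j$), $Y_{ii}=0$, and $k_i=\sum_{j}Y_{ij}$. Let $\mathcal E=\{(i,j):1\le i<j\le n\}$. For $\theta>0$ and $\boldsymbol\beta\in\mathbb R^n$ the degree-corrected two-star ERGM is the probability mass function on $\{-1,1\}^{\mathcal E}$ $$\mathbb P_{n,\theta,\boldsymbol\beta}(Y)=\frac1{Z_n(\boldsymbol\beta,\theta)}\exp\Big\{\frac{\theta}{n-1}\sum_{i=1}^n\sum_{j<k}Y_{ij}Y_{ik}+\frac12\sum_{i=1}^n\beta_ik_i\Big\}.$$ For known $\theta$, $\beta_0$, consider testing $\mathcal H_0:\boldsymbol\beta=\beta_0\mathbf 1$ against $\mathcal H_1:\boldsymbol\beta\in\Xi(s,A)$, where $\Xi(s,A)=\{\beta_0\mathbf 1+\boldsymbol\mu:\ |\mathrm{supp}\,\boldsymbol\mu|\ge s,\ \mu_i\ge A\text{ for all }i\in\mathrm{supp}\,\boldsymbol\mu\}$. The risk of a test $T_n:\{-1,1\}^{\mathcal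 E}\to\{0,1\}$ is $$R(T_n)=\mathbb P_{n,\theta,\beta_0\mathbf 1}(T_n=1)+\sup_{\boldsymbol\beta\in\Xi(s,A)}\mathbb P_{n,\theta,\boldsymbol\beta}(T_n=0).$$ A sequence $(T_n)$ is asymptotically powerful if $R(T_n)\to0$ and asymptotically powerless if $R(T_n)\to1$. We say that all tests are asymptotically powerless if $\liminf_n R(T_n)\ge1$ for every sequence of tests; equivalently, every sequence with $\limsup_nR(T_n)\le 1$ (asymptotically no worse than the test that never rejects, whose risk is $1$) is asymptotically powerless. Write $D_e=Y_e-\mathbb E_{n,\theta,\beta_0\mathbf 1}(Y_e\mid Y_f:f\ne e)$ for $e\in\mathcal E$. The conditionally centered sum test with cut-off $L_n$ rejects ($T_n=1$) iff $\sum_{e\in\mathcal E}D_e>L_n$; the conditionally centered max test with cut-off $L_n$ rejects iff $\max_{i\in[n]}\sum_{e\ni i}D_e>L_n$. **Theorem 3.** Let either $0<\theta<1/2$ and $\beta_0=0$, or $\theta>0$ and $\beta_0\neq0$. There is a constant $C>0$, depending only on $\theta$ and $\beta_0$, such that for all $b\in(0,1)$ and $t<0$ the following hold for the above problem with $s=n^b$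 and $A=n^t$, as $n\to\infty$. (a) If $b\ge\frac12$ and $b+t<0$, then all tests are asymptotically powerless. (b) If $b\ge\frac12$ and $b+t>0$, then for every sequence $L_n$ with $L_n/n\to\infty$ and $L_n/(nsA)\to0$ the conditionally centered sum test with cut-off $L_n$ is asymptotically powerful. (c) If $b<\frac12$ and $t\le-\frac12$, then all tests are asymptotically powerless. (d) If $b<\frac12$ and $t>-\frac12$, then the conditionally centered max test with cut-off $L_n=C\sqrt{n\log n}$ is asymptotically powerful. -/

import Mathlib

open Filter Topology

noncomputable section

namespace TwoStar

/-- The edges `(i, j)`, `i < j`, of the complete graph on `n` labelled vertices. -/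
abbrev Edge (n : ℕ) : Type := {e : Fin n × Fin n // e.1 < e.2}

/-- Simple labelled graphs on `n` vertices, encoded as points of `{-1, 1}^(n choose 2)`:
`Y e = 1` if `e` is an edge of the graph and `Y e = -1` otherwise. -/
abbrev Config (n : ℕ) : Type := Edge n → ℤˣ

/-- The real number `±1` attached to a sign. -/
def spin (u : ℤˣ) : ℝ := ((u : ℤ) : ℝ)

/-- The symmetric `±1` adjacency matrix, with zero diagonal. -/
def adj {n : ℕ} (Y : Config n) (i j : Fin n) : ℝ :=
  if h : i < j then spin (Y ⟨(i, j), h⟩)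
  else if h : j < i then spin (Y ⟨(j, i), h⟩)
  else 0

/-- The "degree" `k_i = ∑_j Y_ij`. -/
def deg {n : ℕ} (Y : Config n) (i : Fin n) : ℝ := ∑ j, adj Y i j

/-- The two-star statistic `∑_i ∑_{j<k} Y_ij Y_ik`. -/
def twoStars {n : ℕ} (Y : Config n) : ℝ :=
  ∑ i, ∑ j, ∑ k, if j < k then adj Y i j * adj Y i k else 0

/-- The unnormalized weight of the degree corrected two-star model. -/
def weight {n : ℕ} (θ : ℝ) (β : Fin n → ℝ) (Y : Config n) : ℝ :=
  Real.exp (θ / ((n : ℝ) - 1) * twoStars Y + (1 / 2) * ∑ i, β i * deg Y i)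

/-- The normalizing constant. -/
def partitionFn {n : ℕ} (θ : ℝ) (β : Fin n → ℝ) : ℝ := ∑ Y : Config n, weight θ β Y

/-- The probability mass function of the degree corrected two-star model. -/
def pmf {n : ℕ} (θ : ℝ) (β : Fin n → ℝ) (Y : Config n) : ℝ :=
  weight θ β Y / partitionFn θ β

open Classical in
/-- The probability of an event under the degree corrected two-star model. -/
def prob {n : ℕ} (θ : ℝ) (β : Fin n → ℝ) (S : Set (Config n)) : ℝ :=
  ∑ Y : Config n, if Y ∈ S then pmf θ β Y else 0

/-- The conditional expectation of `Y_e` given `Y_f`, `f ≠ e`, as a function of the configuration: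
the average of `±1` over the two configurations that agree with `Y` off `e`, weighted by their
probabilities. -/
def condMean {n : ℕ} (θ : ℝ) (β : Fin n → ℝ) (e : Edge n) (Y : Config n) : ℝ :=
  (∑ u : ℤˣ, spin u * pmf θ β (Function.update Y e u)) /
    ∑ u : ℤˣ, pmf θ β (Function.update Y e u)

/-- The set of alternatives: `β = β₀ 1 + μ`, where `μ` has at least `s` nonzero entries and every
nonzero entry is at least `A`. -/
def alternatives (n : ℕ) (β₀ s A : ℝ) : Set (Fin n → ℝ) :=
  {β | ∃ μ : Fin n → ℝ, (∀ i, β i = β₀ + μ i) ∧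
    s ≤ ((Function.support μ).ncard : ℝ) ∧ ∀ i ∈ Function.support μ, A ≤ μ i}

/-- Non-randomized tests; the value `1` means that the null hypothesis is rejected. -/
abbrev Test (n : ℕ) : Type := Config n → Fin 2

/-- The risk: the type I error plus the supremum over the alternatives of the type II error. -/
def risk {n : ℕ} (θ β₀ s A : ℝ) (T : Test n) : ℝ :=
  prob θ (fun _ => β₀) {Y | T Y = 1} +
    ⨆ β : alternatives n β₀ s A, prob θ β.1 {Y | T Y = 0}

/-- The risk tends to `0`. -/
def AsympPowerful (θ β₀ : ℝ) (s A : ℕ → ℝ) (T : ∀ n, Test n) : Prop :=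
  Tendsto (fun n => risk θ β₀ (s n) (A n) (T n)) atTop (𝓝 0)

/-- The risk tends to `1`. -/
def AsympPowerless (θ β₀ : ℝ) (s A : ℕ → ℝ) (T : ∀ n, Test n) : Prop :=
  Tendsto (fun n => risk θ β₀ (s n) (A n) (T n)) atTop (𝓝 1)

/-- All tests are asymptotically powerless: no sequence of tests asymptotically improves on the
risk `1` of the test that never rejects, and every sequence that is asymptotically not worse than
that trivial test has risk tending to `1`. (Perverse tests, which reject under the null hypothesis
and accept under some alternatives, can have risk near `2`.) -/
def AllTestsAsympPowerless (θ β₀ : ℝ) (s A : ℕ → ℝ) : Prop :=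
  (∀ T : ∀ n, Test n, 1 ≤ liminf (fun n => risk θ β₀ (s n) (A n) (T n)) atTop) ∧
  ∀ T : ∀ n, Test n, limsup (fun n => risk θ β₀ (s n) (A n) (T n)) atTop ≤ 1 →
    AsympPowerless θ β₀ s A T

/-- The conditionally centered sum test with cut-off `L`. -/
def sumTest (n : ℕ) (θ β₀ L : ℝ) : Test n := fun Y =>
  if L < ∑ e : Edge n, (spin (Y e) - condMean θ (fun _ => β₀) e Y) then 1 else 0

/-- The conditionally centered degree of the vertex `i`: the sum over the pairs `e ∋ i`. -/
def centeredDeg {n : ℕ} (θ β₀ : ℝ) (i : Fin n) (Y : Config n) : ℝ :=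
  ∑ e : Edge n with e.1.1 = i ∨ e.1.2 = i, (spin (Y e) - condMean θ (fun _ => β₀) e Y)

/-- The conditionally centered maximum degree test with cut-off `L`. -/
def maxTest (n : ℕ) (θ β₀ L : ℝ) : Test n := fun Y =>
  if L < ⨆ i : Fin n, centeredDeg θ β₀ i Y then 1 else 0

/-- The parameter domain `(0, 1/2) × {0} ∪ {(θ, β₀) : θ > 0, β₀ ≠ 0}`. -/
def Theta1 : Set (ℝ × ℝ) :=
  Set.Ioo (0 : ℝ) (1 / 2) ×ˢ {0} ∪ {p | 0 < p.1 ∧ p.2 ≠ 0}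

end TwoStar

end

/-! Up to a constant the two-star statistic is half the sum of the squared degrees. The model is
thus a ferromagnet on the edges, with energy quadratic in the degrees and `β` as a linear field.

Power: the conditional mean of an edge is the tanh of its local field. The residuals about it obey
an integration by parts under the flip of one edge (`gmean_resid_mul`), and one flip moves any sum
of residuals by at most `2 + 4 * θ`. So a sum over a set of edges has variance and exponential
moments governed by the size of the set, for every `θ` and every field. Under an alternative the
null residuals gain a drift of order `A` on each edge that meets the support: in total `n * s * A`
against noise of order `n` for the sum test, and `n * A` at one raised vertex against `√(n log n)`
for the max test.

Powerlessness: by Le Cam's method it suffices that a mixture of alternatives has vanishing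
chi-square divergence from the null. As the field enters linearly, the second moment of the
likelihood ratio is an average of exponentials of mixed second differences of `logZ`, that is, of
integrated covariances of weighted degrees. The key bound is `exists_gcov_wdeg_le`. The GHS
inequality (`gcum_ferro_nonpos`) compares with a constant field. Positive association and
exchangeability then reduce everything to the variance of the number of edges. This is of order `n ^
2` by a self-bounding inequality when `θ < 1 / 2`, and in a positive field because the mean is
bounded and, by GHS, concave in the field; a negative field is reversed by symmetry. Raising one
random vertex in each of `s` blocks leaves an exponent of order `(s * A) ^ 2` as soon as `n * A ^ 2
≤ 1`. -/

noncomputable section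

namespace TwoStar

/-! ### Gibbs averages on finite sets -/

section Gibbs

variable {Ω : Type*} [Fintype Ω]

/-- The Gibbs average of `X` for the weight `exp H`. -/
def gmean (H X : Ω → ℝ) : ℝ := (∑ ω, X ω * Real.exp (H ω)) / ∑ ω, Real.exp (H ω)

/-- The covariance of `X` and `Y` under the Gibbs weight `exp H`. -/
def gcov (H X Y : Ω → ℝ) : ℝ := gmean H (fun ω => X ω * Y ω) - gmean H X * gmean H Y

/-- The third joint cumulant of `X`, `Y` and `W` under the Gibbs weight `exp H`. -/
def gcum (H X Y W : Ω → ℝ) : ℝ :=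
  gmean H (fun ω => X ω * Y ω * W ω) - gmean H (fun ω => X ω * Y ω) * gmean H W
    - gmean H (fun ω => X ω * W ω) * gmean H Y - gmean H (fun ω => Y ω * W ω) * gmean H X
    + 2 * (gmean H X * gmean H Y * gmean H W)

theorem sum_exp_pos [Nonempty Ω] (H : Ω → ℝ) : 0 < ∑ ω, Real.exp (H ω) :=
  Finset.sum_pos (fun _ _ => Real.exp_pos _) Finset.univ_nonempty

theorem gmean_add (H X Y : Ω → ℝ) : gmean H (fun ω => X ω + Y ω) = gmean H X + gmean H Y := by
  simp only [gmean, add_mul, Finset.sum_add_distrib, add_div]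

theorem gmean_const_mul (H X : Ω → ℝ) (c : ℝ) :
    gmean H (fun ω => c * X ω) = c * gmean H X := by
  simp only [gmean, mul_assoc, ← Finset.mul_sum, mul_div_assoc]

theorem gmean_mul_const (H X : Ω → ℝ) (c : ℝ) :
    gmean H (fun ω => X ω * c) = gmean H X * c := by
  simp only [mul_comm _ c, gmean_const_mul]

theorem gmean_sub (H X Y : Ω → ℝ) : gmean H (fun ω => X ω - Y ω) = gmean H X - gmean H Y := by
  simp only [gmean, sub_mul, Finset.sum_sub_distrib, sub_div]

theorem gmean_const [Nonempty Ω] (H : Ω → ℝ) (c : ℝ) : gmean H (fun _ => c) = c := by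
  rw [gmean, ← Finset.mul_sum, mul_div_assoc, div_self (sum_exp_pos H).ne', mul_one]

theorem gmean_sum {ι : Type*} (s : Finset ι) (H : Ω → ℝ) (X : ι → Ω → ℝ) :
    gmean H (fun ω => ∑ i ∈ s, X i ω) = ∑ i ∈ s, gmean H (X i) := by
  simp only [gmean, Finset.sum_mul, Finset.sum_div]
  rw [Finset.sum_comm]

theorem gmean_mono {H X Y : Ω → ℝ} (h : ∀ ω, X ω ≤ Y ω) : gmean H X ≤ gmean H Y := by
  unfold gmean
  gcongr with ω
  exact h ω

theorem abs_gmean_le (H X : Ω → ℝ) : |gmean H X| ≤ gmean H (fun ω => |X ω|) := by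
  unfold gmean
  rw [abs_div, abs_of_nonneg (Finset.sum_nonneg fun _ _ => (Real.exp_pos _).le :
    0 ≤ ∑ ω, Real.exp (H ω))]
  gcongr
  refine (Finset.abs_sum_le_sum_abs _ _).trans (le_of_eq ?_)
  simp only [abs_mul, Real.abs_exp]

/-- Invariance of Gibbs averages under a symmetry of the energy. -/
theorem gmean_comp_equiv {Ω' : Type*} [Fintype Ω'] (σ : Ω' ≃ Ω) (H X : Ω → ℝ) :
    gmean (fun ω => H (σ ω)) (fun ω => X (σ ω)) = gmean H X := by
  unfold gmean
  rw [← Equiv.sum_comp σ (fun ω => X ω * Real.exp (H ω)),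
    ← Equiv.sum_comp σ (fun ω => Real.exp (H ω))]

theorem gcov_comp_equiv {Ω' : Type*} [Fintype Ω'] (σ : Ω' ≃ Ω) (H X Y : Ω → ℝ) :
    gcov (fun ω => H (σ ω)) (fun ω => X (σ ω)) (fun ω => Y (σ ω)) = gcov H X Y := by
  unfold gcov
  rw [← gmean_comp_equiv σ H X, ← gmean_comp_equiv σ H Y,
    ← gmean_comp_equiv σ H (fun ω => X ω * Y ω)]

theorem gcov_add_left (H X X' Y : Ω → ℝ) :
    gcov H (fun ω => X ω + X' ω) Y = gcov H X Y + gcov H X' Y := by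
  simp only [gcov, add_mul, gmean_add]; ring

theorem gcov_comm (H X Y : Ω → ℝ) : gcov H X Y = gcov H Y X := by
  simp only [gcov, mul_comm]

theorem gcov_sub_left (H X X' Y : Ω → ℝ) :
    gcov H (fun ω => X ω - X' ω) Y = gcov H X Y - gcov H X' Y := by
  simp only [gcov, sub_mul, gmean_sub]; ring

theorem gcov_const_mul_left (H X Y : Ω → ℝ) (c : ℝ) :
    gcov H (fun ω => c * X ω) Y = c * gcov H X Y := by
  simp only [gcov, mul_assoc, gmean_const_mul]; ring

theorem gcov_const_mul_right (H X Y : Ω → ℝ) (c : ℝ) :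
    gcov H X (fun ω => c * Y ω) = c * gcov H X Y := by
  rw [gcov_comm, gcov_const_mul_left, gcov_comm]

theorem gcov_sum_left {ι : Type*} (s : Finset ι) (H : Ω → ℝ) (X : ι → Ω → ℝ) (Y : Ω → ℝ) :
    gcov H (fun ω => ∑ i ∈ s, X i ω) Y = ∑ i ∈ s, gcov H (X i) Y := by
  simp only [gcov, Finset.sum_mul, gmean_sum, Finset.sum_sub_distrib]

theorem gcov_sum_right {ι : Type*} (s : Finset ι) (H : Ω → ℝ) (X : Ω → ℝ) (Y : ι → Ω → ℝ) :
    gcov H X (fun ω => ∑ i ∈ s, Y i ω) = ∑ i ∈ s, gcov H X (Y i) := by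
  rw [gcov_comm, gcov_sum_left]
  exact Finset.sum_congr rfl fun i _ => gcov_comm _ _ _

theorem gcov_const_left [Nonempty Ω] (H Y : Ω → ℝ) (c : ℝ) : gcov H (fun _ => c) Y = 0 := by
  simp only [gcov, gmean_const_mul, gmean_const, sub_self]

theorem hasDerivAt_sum_mul_exp (H G X : Ω → ℝ) (t : ℝ) :
    HasDerivAt (fun t : ℝ => ∑ ω, X ω * Real.exp (H ω + t * G ω))
      (∑ ω, X ω * G ω * Real.exp (H ω + t * G ω)) t := by
  refine (HasDerivAt.fun_sum (u := Finset.univ) fun ω _ =>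
    ((((hasDerivAt_id t).mul_const (G ω)).const_add (H ω)).exp.const_mul (X ω))).congr_deriv ?_
  refine Finset.sum_congr rfl fun ω _ => ?_
  simp only [id]
  ring

theorem hasDerivAt_sum_exp (H G : Ω → ℝ) (t : ℝ) :
    HasDerivAt (fun t : ℝ => ∑ ω, Real.exp (H ω + t * G ω))
      (∑ ω, G ω * Real.exp (H ω + t * G ω)) t := by
  simpa using hasDerivAt_sum_mul_exp H G (fun _ => 1) t

/-- Along the tilt `H + t * G` each derivative raises the order of the cumulant by one: log
partition function, mean, covariance, third cumulant. Comparisons of different fields integrate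
these derivatives. -/
theorem hasDerivAt_log_sum_exp [Nonempty Ω] (H G : Ω → ℝ) (t : ℝ) :
    HasDerivAt (fun t : ℝ => Real.log (∑ ω, Real.exp (H ω + t * G ω)))
      (gmean (fun ω => H ω + t * G ω) G) t :=
  (hasDerivAt_sum_exp H G t).log (sum_exp_pos _).ne'

theorem hasDerivAt_gmean [Nonempty Ω] (H G X : Ω → ℝ) (t : ℝ) :
    HasDerivAt (fun t : ℝ => gmean (fun ω => H ω + t * G ω) X)
      (gcov (fun ω => H ω + t * G ω) X G) t := by
  have hZ := (sum_exp_pos (fun ω => H ω + t * G ω)).ne'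
  refine ((hasDerivAt_sum_mul_exp H G X t).div (hasDerivAt_sum_exp H G t) hZ).congr_deriv ?_
  unfold gcov gmean
  generalize (∑ ω, X ω * G ω * Real.exp (H ω + t * G ω)) = a
  generalize (∑ ω, Real.exp (H ω + t * G ω)) = Z at hZ ⊢
  field_simp

theorem hasDerivAt_gcov [Nonempty Ω] (H G X Y : Ω → ℝ) (t : ℝ) :
    HasDerivAt (fun t : ℝ => gcov (fun ω => H ω + t * G ω) X Y)
      (gcum (fun ω => H ω + t * G ω) X Y G) t := by
  refine ((hasDerivAt_gmean H G (fun ω => X ω * Y ω) t).sub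
    ((hasDerivAt_gmean H G X t).mul (hasDerivAt_gmean H G Y t))).congr_deriv ?_
  unfold gcum gcov
  ring

/-- A mean value bound on the unit interval. -/
theorem sub_le_of_hasDerivAt_le {f f' : ℝ → ℝ} {C : ℝ} (hf : ∀ u, HasDerivAt f (f' u) u)
    (hC : ∀ u ∈ Set.Icc (0 : ℝ) 1, f' u ≤ C) : f 1 - f 0 ≤ C := by
  have := (convex_Icc (0 : ℝ) 1).image_sub_le_mul_sub_of_deriv_le (f := f) (C := C)
    (fun u _ => (hf u).continuousAt.continuousWithinAt)
    (fun u _ => (hf u).differentiableAt.differentiableWithinAt)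
    (fun u hu => (hf u).deriv ▸ hC u (interior_subset hu)) 0 (by simp) 1 (by simp) zero_le_one
  simpa using this

end Gibbs

/-! ### The hyperbolic tangent -/

/-- The derivative `1 / cosh ^ 2` lies in `[0, 1]`. Besides the Lipschitz bound, the second
monotonicity lets positive association replace the tanh of a local field by the field itself. -/
theorem monotone_tanh_and_monotone_id_sub_tanh :
    Monotone Real.tanh ∧ Monotone fun x : ℝ => x - Real.tanh x := by
  have hd : ∀ x : ℝ, HasDerivAt Real.tanh (1 / Real.cosh x ^ 2) x := by
    intro x
    have h := (Real.hasDerivAt_sinh x).div (Real.hasDerivAt_cosh x) (Real.cosh_pos x).ne'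
    have e : Real.tanh = Real.sinh / Real.cosh := by
      funext y; simp [Real.tanh_eq_sinh_div_cosh]
    rw [e]
    refine h.congr_deriv ?_
    rw [← Real.cosh_sq_sub_sinh_sq x]; ring
  refine ⟨monotone_of_deriv_nonneg (fun x => (hd x).differentiableAt) fun x => ?_,
    monotone_of_deriv_nonneg (fun x => ((hasDerivAt_id x).sub (hd x)).differentiableAt)
      fun x => ?_⟩
  · rw [(hd x).deriv]; positivity
  · have := ((hasDerivAt_id x).sub (hd x)).deriv
    refine le_of_le_of_eq ?_ this.symm
    have h1 : 1 ≤ Real.cosh x ^ 2 := one_le_pow₀ (Real.one_le_cosh x)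
    rw [sub_nonneg, div_le_one (by positivity)]
    exact h1

theorem abs_tanh_sub_tanh_le (x y : ℝ) : |Real.tanh x - Real.tanh y| ≤ |x - y| := by
  obtain ⟨h1, h2⟩ := monotone_tanh_and_monotone_id_sub_tanh
  rcases le_total x y with h | h
  · have a := h1 h
    have b := h2 h
    simp only at b
    rw [abs_of_nonpos (by linarith), abs_of_nonpos (by linarith)]; linarith
  · have a := h1 h
    have b := h2 h
    simp only at b
    rw [abs_of_nonneg (by linarith), abs_of_nonneg (by linarith)]; linarith

theorem abs_tanh_le_one (x : ℝ) : |Real.tanh x| ≤ 1 := by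
  rw [Real.tanh_eq_sinh_div_cosh, abs_div, abs_of_pos (Real.cosh_pos x),
    div_le_one (Real.cosh_pos x), abs_le]
  constructor
  · have := Real.exp_pos x
    rw [← Real.cosh_add_sinh] at this; linarith
  · have := Real.exp_pos (-x)
    rw [← Real.cosh_sub_sinh] at this; linarith

/-- The addition formula writes the increment as `sinh x / (cosh (h + x) * cosh h)`. The truncation
`x ≤ y` is needed because the entries of an alternative have no upper bound. -/
theorem le_tanh_add_sub_tanh {M h x y : ℝ} (hM : |h| ≤ M) (hx : 0 ≤ x) (hx1 : x ≤ 1)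
    (hxy : x ≤ y) : x / Real.cosh (M + 1) ^ 2 ≤ Real.tanh (h + y) - Real.tanh h := by
  have hmono := monotone_tanh_and_monotone_id_sub_tanh.1 (by linarith : h + x ≤ h + y)
  refine le_trans ?_ (sub_le_sub_right hmono _)
  have e : Real.tanh (h + x) - Real.tanh h = Real.sinh x / (Real.cosh (h + x) * Real.cosh h) := by
    have h1 := (Real.cosh_pos (h + x)).ne'
    have h2 := (Real.cosh_pos h).ne'
    rw [Real.tanh_eq_sinh_div_cosh, Real.tanh_eq_sinh_div_cosh, div_sub_div _ _ h1 h2]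
    congr 1
    rw [← Real.sinh_sub, add_sub_cancel_left]
  have hM0 : 0 ≤ M := (abs_nonneg h).trans hM
  have c1 : Real.cosh (h + x) ≤ Real.cosh (M + 1) := by
    rw [Real.cosh_le_cosh, abs_of_nonneg (by linarith : 0 ≤ M + 1)]
    exact (abs_add_le _ _).trans (add_le_add hM (by rwa [abs_of_nonneg hx]))
  have c2 : Real.cosh h ≤ Real.cosh (M + 1) := by
    rw [Real.cosh_le_cosh, abs_of_nonneg (by linarith : 0 ≤ M + 1)]
    linarith
  have p1 := Real.cosh_pos (h + x)
  have p2 := Real.cosh_pos h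
  rw [e, sq]
  exact div_le_div₀ (Real.sinh_nonneg_iff.2 hx) (Real.self_le_sinh_iff.2 hx) (by positivity)
    (by gcongr)

/-! ### The Griffiths–Hurst–Sherman inequality

The proof uses four replicas of the spin system and the orthogonal change of variables
of Ellis and Monroe. -/

theorem spin_one : spin 1 = 1 := by simp [spin]

theorem spin_neg (u : ℤˣ) : spin (-u) = -spin u := by simp [spin]

theorem spin_eq_one_or (u : ℤˣ) : spin u = 1 ∨ spin u = -1 := by
  rcases Int.units_eq_one_or u with rfl | rfl
  · exact Or.inl spin_one
  · exact Or.inr (by rw [spin_neg, spin_one])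

theorem spin_mul_self (u : ℤˣ) : spin u * spin u = 1 := by
  rcases spin_eq_one_or u with h | h <;> rw [h] <;> norm_num

theorem abs_spin (u : ℤˣ) : |spin u| = 1 := by
  rcases spin_eq_one_or u with h | h <;> rw [h] <;> norm_num

theorem sum_units (f : ℤˣ → ℝ) : ∑ u, f u = f 1 + f (-1) := by
  rw [UnitsInt.univ, Finset.sum_pair (by decide)]

section GHS

/-- The spins of four replicas at one site. -/
abbrev Quad : Type := ℤˣ × ℤˣ × ℤˣ × ℤˣ

/-- Signs of the orthogonal change of variables for four replicas. -/
def quadForm (x : Fin 4) (s₁ s₂ s₃ s₄ : ℝ) : ℝ :=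
  ![s₁ + s₂ + s₃ + s₄, s₁ + s₂ - s₃ - s₄, s₁ - s₂ + s₃ - s₄, -s₁ + s₂ + s₃ - s₄] x / 2

/-- The rotated spins at one site. -/
def rot (x : Fin 4) (q : Quad) : ℝ :=
  quadForm x (spin q.1) (spin q.2.1) (spin q.2.2.1) (spin q.2.2.2)

theorem two_pow_add_neg_two_pow_nonneg (i : ℕ) : (0 : ℝ) ≤ 2 ^ i + (-2) ^ i := by
  rcases Nat.even_or_odd i with h | h
  · rw [h.neg_pow]; positivity
  · rw [h.neg_pow]; simp

/-- Of the sixteen spin quadruples, eight rotate to a vector with a single nonzero entry `±2`. The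
other eight rotate to the sign vectors with an even number of minus signs, over which a monomial
sums to `8` or `0` according to the parities of its exponents. The sign of the last row of
`quadForm` is what makes this number even. -/
theorem sum_rot_monomial_nonneg (m : Fin 4 → ℕ) : 0 ≤ ∑ q : Quad, ∏ x, rot x q ^ m x := by
  simp only [Fintype.sum_prod_type, sum_units, Fin.prod_univ_four, rot, quadForm, spin_neg,
    spin_one]
  generalize m 0 = i
  generalize m 1 = j
  generalize m 2 = k
  generalize m 3 = l
  simp only [Matrix.cons_val]
  norm_num
  have h1 : (0 : ℝ) ≤ (2 ^ i + (-2) ^ i) * 0 ^ j * 0 ^ k * 0 ^ l :=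
    mul_nonneg (mul_nonneg (mul_nonneg (two_pow_add_neg_two_pow_nonneg i) (by positivity))
      (by positivity)) (by positivity)
  have h2 : (0 : ℝ) ≤ (2 ^ j + (-2) ^ j) * 0 ^ i * 0 ^ k * 0 ^ l :=
    mul_nonneg (mul_nonneg (mul_nonneg (two_pow_add_neg_two_pow_nonneg j) (by positivity))
      (by positivity)) (by positivity)
  have h3 : (0 : ℝ) ≤ (2 ^ k + (-2) ^ k) * 0 ^ i * 0 ^ j * 0 ^ l :=
    mul_nonneg (mul_nonneg (mul_nonneg (two_pow_add_neg_two_pow_nonneg k) (by positivity))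
      (by positivity)) (by positivity)
  have h4 : (0 : ℝ) ≤ (2 ^ l + (-2) ^ l) * 0 ^ i * 0 ^ j * 0 ^ k :=
    mul_nonneg (mul_nonneg (mul_nonneg (two_pow_add_neg_two_pow_nonneg l) (by positivity))
      (by positivity)) (by positivity)
  rcases neg_one_pow_eq_or ℝ i with hi | hi <;> rcases neg_one_pow_eq_or ℝ j with hj | hj <;>
    rcases neg_one_pow_eq_or ℝ k with hk | hk <;> rcases neg_one_pow_eq_or ℝ l with hl | hl <;>
    rw [hi, hj, hk, hl] <;> linarith

variable {E : Type*}

/-- The functions of four replicas that are polynomials with nonnegative coefficients in the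
rotated spins. -/
def posCone (E : Type*) : Subsemiring ((E → Quad) → ℝ) :=
  Subsemiring.closure ({G | ∃ c : ℝ, 0 ≤ c ∧ G = fun _ => c} ∪
    {G | ∃ (e : E) (x : Fin 4), G = fun q => rot x (q e)})

theorem const_mem_posCone {c : ℝ} (hc : 0 ≤ c) : (fun _ => c) ∈ posCone E :=
  Subsemiring.subset_closure (Or.inl ⟨c, hc, rfl⟩)

theorem rot_mem_posCone (e : E) (x : Fin 4) : (fun q => rot x (q e)) ∈ posCone E :=
  Subsemiring.subset_closure (Or.inr ⟨e, x, rfl⟩)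

variable [Fintype E]

theorem sum_rot_mem_posCone {c : E → ℝ} (hc : ∀ e, 0 ≤ c e) (x : Fin 4) :
    (fun q => ∑ e, c e * rot x (q e)) ∈ posCone E := by
  have : (fun q : E → Quad => ∑ e, c e * rot x (q e)) =
      ∑ e, (fun _ => c e) * fun q => rot x (q e) := by
    funext q; simp
  rw [this]
  exact sum_mem fun e _ => mul_mem (const_mem_posCone (hc e)) (rot_mem_posCone e x)

/-- The cone is additively generated by monomials with nonnegative coefficients. The sum of a
monomial over all replicas factorizes over the sites, leaving `sum_rot_monomial_nonneg` at each
site. -/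
theorem sum_nonneg_of_mem_posCone [DecidableEq E] {G : (E → Quad) → ℝ} (hG : G ∈ posCone E) :
    0 ≤ ∑ q, G q := by
  rw [posCone, Subsemiring.mem_closure_iff] at hG
  induction hG using AddSubmonoid.closure_induction with
  | zero => simp
  | add G G' _ _ h h' =>
    simp only [Pi.add_apply, Finset.sum_add_distrib]
    exact add_nonneg h h'
  | mem G hG =>
    have key : ∃ (c : ℝ) (m : E → Fin 4 → ℕ), 0 ≤ c ∧
        G = fun q => c * ∏ e, ∏ x, rot x (q e) ^ m e x := by
      induction hG using Submonoid.closure_induction with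
      | one => exact ⟨1, fun _ _ => 0, zero_le_one, by funext q; simp⟩
      | mul G G' _ _ h h' =>
        obtain ⟨c, m, hc, rfl⟩ := h
        obtain ⟨c', m', hc', rfl⟩ := h'
        refine ⟨c * c', m + m', mul_nonneg hc hc', ?_⟩
        funext q
        simp only [Pi.mul_apply, Pi.add_apply, pow_add, Finset.prod_mul_distrib]
        ring
      | mem G hG =>
        rcases hG with ⟨c, hc, rfl⟩ | ⟨e, x, rfl⟩
        · exact ⟨c, fun _ _ => 0, hc, by funext q; simp⟩
        · refine ⟨1, fun e' x' => if e' = e ∧ x' = x then 1 else 0, zero_le_one, ?_⟩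
          funext q
          rw [one_mul, Finset.prod_eq_single e, Finset.prod_eq_single x] <;> simp +contextual
    obtain ⟨c, m, hc, rfl⟩ := key
    rw [← Finset.mul_sum]
    refine mul_nonneg hc ?_
    rw [← Fintype.prod_sum fun (e : E) (q : Quad) => ∏ x, rot x q ^ m e x]
    exact Finset.prod_nonneg fun e _ => sum_rot_monomial_nonneg (m e)

/-- Each term of the exponential series stays in the cone. -/
theorem sum_mul_exp_nonneg_of_mem_posCone [DecidableEq E] {F G : (E → Quad) → ℝ}
    (hF : F ∈ posCone E) (hG : G ∈ posCone E) : 0 ≤ ∑ q, F q * Real.exp (G q) := by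
  have h : HasSum (fun k : ℕ => ∑ q, F q * (G q ^ k / k.factorial))
      (∑ q, F q * Real.exp (G q)) := by
    refine hasSum_sum fun q _ => ?_
    rw [Real.exp_eq_exp_ℝ]
    exact (NormedSpace.expSeries_div_hasSum_exp (G q)).mul_left _
  refine h.nonneg fun k => ?_
  have := sum_nonneg_of_mem_posCone (mul_mem (mul_mem hF (pow_mem hG k))
    (const_mem_posCone (E := E) (by positivity : (0 : ℝ) ≤ 1 / (k.factorial : ℝ))))
  refine le_of_le_of_eq this (Finset.sum_congr rfl fun q _ => ?_)
  simp only [Pi.mul_apply, Pi.pow_apply]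
  ring

/-- The linear form with coefficients `c` on spin configurations. -/
def lin (c : E → ℝ) (Y : E → ℤˣ) : ℝ := ∑ e, c e * spin (Y e)

theorem quadForm_lin (x : Fin 4) (c : E → ℝ) (q : E → Quad) :
    quadForm x (lin c fun e => (q e).1) (lin c fun e => (q e).2.1)
      (lin c fun e => (q e).2.2.1) (lin c fun e => (q e).2.2.2) = ∑ e, c e * rot x (q e) := by
  have h : ∀ e, c e * rot x (q e) = quadForm x (c e * spin (q e).1) (c e * spin (q e).2.1)
      (c e * spin (q e).2.2.1) (c e * spin (q e).2.2.2) := by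
    intro e
    fin_cases x <;> simp only [rot, quadForm, Fin.zero_eta, Fin.mk_one, Fin.reduceFinMk,
      Matrix.cons_val] <;> ring
  simp only [h]
  unfold lin
  fin_cases x <;> simp only [quadForm, Fin.zero_eta, Fin.mk_one, Fin.reduceFinMk,
    Matrix.cons_val, ← Finset.sum_div, Finset.sum_add_distrib, Finset.sum_sub_distrib,
    Finset.sum_neg_distrib]

theorem sum_sq_eq_quadForm (a b c d : ℝ) :
    a ^ 2 + b ^ 2 + c ^ 2 + d ^ 2 = ∑ x, quadForm x a b c d ^ 2 := by
  simp only [Fin.sum_univ_four, quadForm, Matrix.cons_val]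
  ring

/-- A ferromagnetic energy: a sum of squares of nonnegative linear forms plus a linear form. -/
def ferro {ι : Type*} [Fintype ι] (c : ι → E → ℝ) (h : E → ℝ) (Y : E → ℤˣ) : ℝ :=
  ∑ i, lin (c i) Y ^ 2 + lin h Y

/-- By orthogonality of the rotation, four copies of the quadratic energy form a sum of squares of
rotated forms, again with nonnegative coefficients. The field couples only to coordinate `0`, with
factor `2`. So the exponent and the prefactor both lie in `posCone`. -/
theorem sum_replicas_nonneg [DecidableEq E] {ι : Type*} [Fintype ι] {c : ι → E → ℝ}
    {h u v w : E → ℝ} (hc : ∀ i e, 0 ≤ c i e) (hh : ∀ e, 0 ≤ h e) (hu : ∀ e, 0 ≤ u e)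
    (hv : ∀ e, 0 ≤ v e) (hw : ∀ e, 0 ≤ w e) :
    0 ≤ ∑ p : (E → ℤˣ) × (E → ℤˣ) × (E → ℤˣ) × (E → ℤˣ),
      quadForm 1 (lin u p.1) (lin u p.2.1) (lin u p.2.2.1) (lin u p.2.2.2) *
      quadForm 2 (lin v p.1) (lin v p.2.1) (lin v p.2.2.1) (lin v p.2.2.2) *
      quadForm 3 (lin w p.1) (lin w p.2.1) (lin w p.2.2.1) (lin w p.2.2.2) *
      Real.exp (ferro c h p.1 + ferro c h p.2.1 + ferro c h p.2.2.1 + ferro c h p.2.2.2) := by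
  let φ : (E → Quad) ≃ (E → ℤˣ) × (E → ℤˣ) × (E → ℤˣ) × (E → ℤˣ) :=
    { toFun := fun q => (fun e => (q e).1, fun e => (q e).2.1, fun e => (q e).2.2.1,
        fun e => (q e).2.2.2)
      invFun := fun p e => (p.1 e, p.2.1 e, p.2.2.1 e, p.2.2.2 e)
      left_inv := fun _ => rfl
      right_inv := fun _ => rfl }
  rw [← Equiv.sum_comp φ]
  have hF := mul_mem (mul_mem (sum_rot_mem_posCone hu 1) (sum_rot_mem_posCone hv 2))
    (sum_rot_mem_posCone hw 3)
  have hG : (fun q : E → Quad => ∑ i, ∑ x, (∑ e, c i e * rot x (q e)) ^ 2 +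
      2 * ∑ e, h e * rot 0 (q e)) ∈ posCone E := by
    have : (fun q : E → Quad => ∑ i, ∑ x, (∑ e, c i e * rot x (q e)) ^ 2 +
        2 * ∑ e, h e * rot 0 (q e)) = ∑ i, ∑ x, (fun q => ∑ e, c i e * rot x (q e)) ^ 2 +
          (fun _ => 2) * fun q => ∑ e, h e * rot 0 (q e) := by
      funext q; simp
    rw [this]
    exact add_mem (sum_mem fun i _ => sum_mem fun x _ =>
      pow_mem (sum_rot_mem_posCone (hc i) x) 2)
      (mul_mem (const_mem_posCone zero_le_two) (sum_rot_mem_posCone hh 0))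
  refine le_of_le_of_eq (sum_mul_exp_nonneg_of_mem_posCone hF hG)
    (Finset.sum_congr rfl fun q _ => ?_)
  simp only [Pi.mul_apply, φ, Equiv.coe_fn_mk, quadForm_lin]
  congr 2
  simp only [← quadForm_lin, ← sum_sq_eq_quadForm, Finset.sum_add_distrib, ferro]
  simp only [quadForm, Matrix.cons_val]
  ring

/-- The shape `x y z + α x + β y + γ z + δ` is preserved when one centered replica is averaged out,
so four applications evaluate the whole replica average. -/
theorem gmean_replica_step {Ω : Type*} [Fintype Ω] [Nonempty Ω] {H X Y W : Ω → ℝ}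
    (hX : gmean H X = 0) (hY : gmean H Y = 0) (hW : gmean H W = 0)
    (ε₁ ε₂ ε₃ α β γ δ x y z : ℝ) :
    gmean H (fun ω => (x + ε₁ * X ω) * (y + ε₂ * Y ω) * (z + ε₃ * W ω) + α * (x + ε₁ * X ω) +
      β * (y + ε₂ * Y ω) + γ * (z + ε₃ * W ω) + δ) =
    x * y * z + (α + ε₂ * ε₃ * gmean H (fun ω => Y ω * W ω)) * x +
      (β + ε₁ * ε₃ * gmean H (fun ω => X ω * W ω)) * y +
      (γ + ε₁ * ε₂ * gmean H (fun ω => X ω * Y ω)) * z +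
      (δ + ε₁ * ε₂ * ε₃ * gmean H (fun ω => X ω * Y ω * W ω)) := by
  have e : (fun ω => (x + ε₁ * X ω) * (y + ε₂ * Y ω) * (z + ε₃ * W ω) + α * (x + ε₁ * X ω) +
      β * (y + ε₂ * Y ω) + γ * (z + ε₃ * W ω) + δ) = fun ω =>
      ε₁ * ε₂ * ε₃ * (X ω * Y ω * W ω) + x * ε₂ * ε₃ * (Y ω * W ω) + y * ε₁ * ε₃ * (X ω * W ω) +
      z * ε₁ * ε₂ * (X ω * Y ω) + (ε₁ * y * z + α * ε₁) * X ω + (ε₂ * x * z + β * ε₂) * Y ω +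
      (ε₃ * x * y + γ * ε₃) * W ω + (x * y * z + α * x + β * y + γ * z + δ) := by
    funext ω; ring
  rw [e]
  simp only [gmean_add, gmean_const_mul, gmean_const, hX, hY, hW]
  ring

theorem gmean_four {Ω : Type*} [Fintype Ω] (H : Ω → ℝ) (Φ : Ω × Ω × Ω × Ω → ℝ) :
    gmean H (fun a => gmean H fun b => gmean H fun c => gmean H fun d => Φ (a, b, c, d)) =
      (∑ p : Ω × Ω × Ω × Ω, Φ p * Real.exp (H p.1 + H p.2.1 + H p.2.2.1 + H p.2.2.2)) /
        (∑ ω, Real.exp (H ω)) ^ 4 := by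
  simp only [gmean, Fintype.sum_prod_type, Finset.sum_div, Finset.sum_mul, Real.exp_add]
  refine Finset.sum_congr rfl fun a _ => Finset.sum_congr rfl fun b _ =>
    Finset.sum_congr rfl fun c _ => Finset.sum_congr rfl fun d _ => ?_
  ring

theorem gmean_centered {Ω : Type*} [Fintype Ω] [Nonempty Ω] (H X : Ω → ℝ) :
    gmean H (fun ω => X ω - gmean H X) = 0 := by
  rw [gmean_sub, gmean_const, sub_self]

theorem gcum_eq_centered {Ω : Type*} [Fintype Ω] [Nonempty Ω] (H X Y W : Ω → ℝ) :
    gcum H X Y W = gmean H (fun ω =>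
      (X ω - gmean H X) * (Y ω - gmean H Y) * (W ω - gmean H W)) := by
  generalize hx : gmean H X = x
  generalize hy : gmean H Y = y
  generalize hw : gmean H W = w
  have e : (fun ω => (X ω - x) * (Y ω - y) * (W ω - w)) = fun ω => X ω * Y ω * W ω -
      w * (X ω * Y ω) - y * (X ω * W ω) - x * (Y ω * W ω) + y * w * X ω + x * w * Y ω +
      x * y * W ω - x * y * w := by
    funext ω; ring
  rw [e]
  simp only [gmean_add, gmean_sub, gmean_const_mul, gmean_const, gcum, hx, hy, hw]
  ring

/-- The third cumulant as a four-replica average. -/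
theorem gmean_replicas_eq_gcum {Ω : Type*} [Fintype Ω] [Nonempty Ω] (H X Y W : Ω → ℝ) :
    gmean H (fun a => gmean H fun b => gmean H fun c => gmean H fun d =>
      quadForm 1 (X a) (X b) (X c) (X d) * quadForm 2 (Y a) (Y b) (Y c) (Y d) *
        quadForm 3 (W a) (W b) (W c) (W d)) = -(1 / 2) * gcum H X Y W := by
  rw [gcum_eq_centered]
  have hX := gmean_centered H X
  have hY := gmean_centered H Y
  have hW := gmean_centered H W
  set X' := fun ω => X ω - gmean H X with hX'
  set Y' := fun ω => Y ω - gmean H Y with hY'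
  set W' := fun ω => W ω - gmean H W with hW'
  -- Rows `1`, `2`, `3` of the rotation sum to zero, so centering costs nothing. The null terms only
  -- produce the shape of `gmean_replica_step`. Each replica contributes sign product `-1`, whence
  -- `-4 / 8`.
  have e : ∀ a b c d, quadForm 1 (X a) (X b) (X c) (X d) * quadForm 2 (Y a) (Y b) (Y c) (Y d) *
        quadForm 3 (W a) (W b) (W c) (W d) = 1 / 8 *
      (((((0 + 1 * X' a) + 1 * X' b) + (-1) * X' c) + (-1) * X' d) *
      ((((0 + 1 * Y' a) + (-1) * Y' b) + 1 * Y' c) + (-1) * Y' d) *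
      ((((0 + (-1) * W' a) + 1 * W' b) + 1 * W' c) + (-1) * W' d) +
      0 * ((((0 + 1 * X' a) + 1 * X' b) + (-1) * X' c) + (-1) * X' d) +
      0 * ((((0 + 1 * Y' a) + (-1) * Y' b) + 1 * Y' c) + (-1) * Y' d) +
      0 * ((((0 + (-1) * W' a) + 1 * W' b) + 1 * W' c) + (-1) * W' d) + 0) := by
    intro a b c d
    simp only [quadForm, Matrix.cons_val, hX', hY', hW']
    ring
  simp only [e, gmean_const_mul]
  simp only [gmean_replica_step hX hY hW]
  ring

/-- The **Griffiths–Hurst–Sherman inequality**: in a ferromagnet with nonnegative fields the third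
cumulants of nonnegative linear forms are nonpositive. -/
theorem gcum_ferro_nonpos [DecidableEq E] {ι : Type*} [Fintype ι] {c : ι → E → ℝ}
    {h u v w : E → ℝ} (hc : ∀ i e, 0 ≤ c i e) (hh : ∀ e, 0 ≤ h e) (hu : ∀ e, 0 ≤ u e)
    (hv : ∀ e, 0 ≤ v e) (hw : ∀ e, 0 ≤ w e) :
    gcum (ferro c h) (lin u) (lin v) (lin w) ≤ 0 := by
  have h1 := gmean_replicas_eq_gcum (ferro c h) (lin u) (lin v) (lin w)
  have h2 := gmean_four (ferro c h) fun p =>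
    quadForm 1 (lin u p.1) (lin u p.2.1) (lin u p.2.2.1) (lin u p.2.2.2) *
      quadForm 2 (lin v p.1) (lin v p.2.1) (lin v p.2.2.1) (lin v p.2.2.2) *
      quadForm 3 (lin w p.1) (lin w p.2.1) (lin w p.2.2.1) (lin w p.2.2.2)
  have h3 := div_nonneg (sum_replicas_nonneg hc hh hu hv hw)
    (pow_nonneg (sum_exp_pos (ferro c h)).le 4)
  rw [← h2, h1] at h3
  linarith

end GHS

/-! ### Edges, degrees and the energy -/

section Combinatorics

variable {n : ℕ}

/-- The incidence indicator of a vertex and an edge. -/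
def inc (i : Fin n) (e : Edge n) : ℝ := if e.1.1 = i ∨ e.1.2 = i then 1 else 0

theorem inc_nonneg (i : Fin n) (e : Edge n) : 0 ≤ inc i e := by
  unfold inc; split_ifs <;> norm_num

theorem inc_mul_self (i : Fin n) (e : Edge n) : inc i e * inc i e = inc i e := by
  unfold inc; split_ifs <;> norm_num

/-- The symmetric extension of a function on edges to pairs of vertices. -/
def symmExt (f : Edge n → ℝ) (i j : Fin n) : ℝ :=
  if h : i < j then f ⟨(i, j), h⟩ else if h : j < i then f ⟨(j, i), h⟩ else 0

theorem sum_edge_ite (p : Fin n × Fin n) (f : Edge n → ℝ) :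
    ∑ e : Edge n, (if e.1 = p then f e else 0) = if h : p.1 < p.2 then f ⟨p, h⟩ else 0 := by
  by_cases h : p.1 < p.2
  · rw [dif_pos h, Finset.sum_eq_single (⟨p, h⟩ : Edge n)]
    · simp
    · intro e _ he
      rw [if_neg fun h' => he (Subtype.ext h')]
    · simp
  · rw [dif_neg h]
    refine Finset.sum_eq_zero fun e _ => if_neg ?_
    rintro rfl
    exact h e.2

theorem sum_inc_mul (f : Edge n → ℝ) (i : Fin n) :
    ∑ e, inc i e * f e = ∑ j, symmExt f i j := by
  have h1 : ∀ e : Edge n, inc i e * f e =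
      ∑ j, ((if e.1 = (i, j) then f e else 0) + if e.1 = (j, i) then f e else 0) := by
    rintro ⟨⟨a, b⟩, hab⟩
    simp only [inc, Prod.mk.injEq, Finset.sum_add_distrib]
    have hne : a ≠ b := ne_of_lt hab
    by_cases ha : a = i <;> by_cases hb : b = i
    · exact absurd (ha.trans hb.symm) hne
    all_goals simp [ha, hb]
  simp only [h1]
  rw [Finset.sum_comm]
  refine Finset.sum_congr rfl fun j _ => ?_
  rw [Finset.sum_add_distrib, sum_edge_ite, sum_edge_ite, symmExt]
  by_cases h : i < j
  · simp [h, not_lt_of_ge h.le]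
  · simp [h]

theorem deg_eq_lin (Y : Config n) (i : Fin n) : deg Y i = lin (inc i) Y := by
  unfold lin
  rw [sum_inc_mul]
  rfl

theorem sum_inc_vertex (e : Edge n) : ∑ i, inc i e = 2 := by
  obtain ⟨⟨a, b⟩, hab⟩ := e
  have hne : a ≠ b := ne_of_lt hab
  have : ∀ i, inc i ⟨(a, b), hab⟩ = (if a = i then 1 else 0) + if b = i then 1 else 0 := by
    intro i
    unfold inc
    by_cases ha : a = i <;> by_cases hb : b = i
    · exact absurd (ha.trans hb.symm) hne
    all_goals simp [ha, hb]
  simp only [this, Finset.sum_add_distrib, Finset.sum_ite_eq, Finset.mem_univ, if_true]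
  norm_num

theorem sum_inc_edge (i : Fin n) : ∑ e, inc i e = (n : ℝ) - 1 := by
  have h := sum_inc_mul (fun _ : Edge n => 1) i
  simp only [mul_one] at h
  rw [h]
  have : ∀ j, symmExt (fun _ : Edge n => 1) i j = 1 - if i = j then 1 else 0 := by
    intro j
    unfold symmExt
    rcases lt_trichotomy i j with h | h | h
    · simp [h, h.ne]
    · simp [h]
    · simp [h, not_lt_of_ge h.le, h.ne']
  simp [this]

theorem sum_ite_lt_mul (a : Fin n → ℝ) :
    ∑ j, ∑ k, (if j < k then a j * a k else 0) = ((∑ j, a j) ^ 2 - ∑ j, a j ^ 2) / 2 := by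
  have h : (∑ j, a j) ^ 2 = ∑ j, ∑ k, ((if j < k then a j * a k else 0) +
      (if k < j then a k * a j else 0) + if j = k then a j ^ 2 else 0) := by
    rw [sq, Finset.sum_mul_sum]
    refine Finset.sum_congr rfl fun j _ => Finset.sum_congr rfl fun k _ => ?_
    rcases lt_trichotomy j k with h | h | h
    · simp [h, h.ne, not_lt_of_ge h.le]
    · simp [h, sq]
    · simp [h, h.ne', not_lt_of_ge h.le, mul_comm]
  simp only [Finset.sum_add_distrib] at h
  rw [Finset.sum_comm (f := fun j k => if k < j then a k * a j else 0)] at h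
  simp only [Finset.sum_ite_eq, Finset.mem_univ, if_true] at h
  rw [h]; ring

theorem adj_sq (Y : Config n) (i j : Fin n) : adj Y i j ^ 2 = 1 - if i = j then 1 else 0 := by
  unfold adj
  rcases lt_trichotomy i j with h | h | h
  · simp [h, h.ne, sq, spin_mul_self]
  · simp [h]
  · simp [h, not_lt_of_ge h.le, h.ne', sq, spin_mul_self]

/-- Since `Y_ij ^ 2 = 1` off the diagonal, the squared degree is twice the number of signed pairs at
the vertex plus `n - 1`. -/
theorem twoStars_eq (Y : Config n) :
    twoStars Y = (∑ i, deg Y i ^ 2) / 2 - n * ((n : ℝ) - 1) / 2 := by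
  unfold twoStars deg
  simp only [sum_ite_lt_mul, adj_sq]
  simp only [Finset.sum_sub_distrib, Finset.sum_const, Finset.card_univ, Fintype.card_fin,
    Finset.sum_ite_eq, Finset.mem_univ, if_true, ← Finset.sum_div, nsmul_eq_mul, mul_one]
  ring

/-- The energy of the degree corrected two-star model, up to an additive constant. -/
def energy (θ : ℝ) (β : Fin n → ℝ) (Y : Config n) : ℝ :=
  θ / (2 * ((n : ℝ) - 1)) * ∑ i, deg Y i ^ 2 + 1 / 2 * ∑ i, β i * deg Y i

theorem pmf_eq (θ : ℝ) (β : Fin n → ℝ) (Y : Config n) :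
    pmf θ β Y = Real.exp (energy θ β Y) / ∑ Y, Real.exp (energy θ β Y) := by
  have h : ∀ Y, weight θ β Y = Real.exp (energy θ β Y) *
      Real.exp (-(θ / ((n : ℝ) - 1) * (n * ((n : ℝ) - 1) / 2))) := by
    intro Y
    rw [weight, ← Real.exp_add, twoStars_eq, energy]
    congr 1
    rw [mul_comm 2 ((n : ℝ) - 1), ← div_div]
    ring
  rw [pmf, partitionFn]
  simp only [h, ← Finset.sum_mul]
  exact mul_div_mul_right _ _ (Real.exp_pos _).ne'

open Classical in
theorem prob_eq_gmean (θ : ℝ) (β : Fin n → ℝ) (S : Set (Config n)) :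
    prob θ β S = gmean (energy θ β) fun Y => if Y ∈ S then 1 else 0 := by
  unfold prob gmean
  rw [Finset.sum_div]
  refine Finset.sum_congr rfl fun Y _ => ?_
  rw [pmf_eq]
  by_cases h : Y ∈ S <;> simp [h]

theorem prob_nonneg (θ : ℝ) (β : Fin n → ℝ) (S : Set (Config n)) : 0 ≤ prob θ β S := by
  classical
  rw [prob_eq_gmean]
  refine (gmean_const (energy θ β) 0).symm.trans_le (gmean_mono fun Y => ?_)
  split_ifs <;> norm_num

theorem prob_le_one (θ : ℝ) (β : Fin n → ℝ) (S : Set (Config n)) : prob θ β S ≤ 1 := by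
  classical
  rw [prob_eq_gmean]
  refine (gmean_mono fun Y => ?_).trans_eq (gmean_const (energy θ β) 1)
  split_ifs <;> norm_num

theorem prob_le_gmean (θ : ℝ) (β : Fin n → ℝ) {S : Set (Config n)} {G : Config n → ℝ}
    (h0 : ∀ Y, 0 ≤ G Y) (h1 : ∀ Y ∈ S, 1 ≤ G Y) : prob θ β S ≤ gmean (energy θ β) G := by
  classical
  rw [prob_eq_gmean]
  refine gmean_mono fun Y => ?_
  split_ifs with h
  · exact h1 Y h
  · exact h0 Y

/-! ### Conditional means -/

/-- The configuration with the sign of the edge `e` reversed. -/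
def flip (e : Edge n) (Y : Config n) : Config n := Function.update Y e (-Y e)

theorem flip_apply_self (e : Edge n) (Y : Config n) : flip e Y e = -Y e := by simp [flip]

theorem flip_apply_of_ne {e f : Edge n} (h : f ≠ e) (Y : Config n) : flip e Y f = Y f := by
  simp [flip, h]

theorem flip_flip (e : Edge n) (Y : Config n) : flip e (flip e Y) = Y := by
  funext f
  by_cases h : f = e
  · subst h; simp [flip_apply_self]
  · simp [flip_apply_of_ne h]

/-- Reversing the sign of one edge, as a permutation of the configurations. -/
def flipEquiv (e : Edge n) : Equiv.Perm (Config n) :=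
  ⟨flip e, flip e, flip_flip e, flip_flip e⟩

theorem deg_flip (e : Edge n) (Y : Config n) (i : Fin n) :
    deg (flip e Y) i = deg Y i - 2 * inc i e * spin (Y e) := by
  have : ∀ f, inc i f * spin (flip e Y f) =
      inc i f * spin (Y f) - if f = e then 2 * inc i e * spin (Y e) else 0 := by
    intro f
    by_cases h : f = e
    · subst h; rw [flip_apply_self, spin_neg, if_pos rfl]; ring
    · rw [flip_apply_of_ne h, if_neg h, sub_zero]
  simp only [deg_eq_lin, lin, this, Finset.sum_sub_distrib, Finset.sum_ite_eq', Finset.mem_univ,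
    if_true]

/-- The local field acting on the edge `e`. -/
def localField (θ : ℝ) (β : Fin n → ℝ) (e : Edge n) (Y : Config n) : ℝ :=
  ∑ i, inc i e * (θ / ((n : ℝ) - 1) * (deg Y i - spin (Y e)) + β i / 2)

theorem localField_flip_self (θ : ℝ) (β : Fin n → ℝ) (e : Edge n) (Y : Config n) :
    localField θ β e (flip e Y) = localField θ β e Y := by
  refine Finset.sum_congr rfl fun i _ => ?_
  rw [deg_flip, flip_apply_self, spin_neg]
  linear_combination (-2 * spin (Y e) * (θ / ((n : ℝ) - 1))) * inc_mul_self i e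

/-- The second-order term of the squared degrees is exactly the self-interaction that `localField`
subtracts. -/
theorem energy_flip (θ : ℝ) (β : Fin n → ℝ) (e : Edge n) (Y : Config n) :
    energy θ β (flip e Y) = energy θ β Y - 2 * spin (Y e) * localField θ β e Y := by
  unfold energy localField
  simp only [deg_flip, Finset.mul_sum, ← Finset.sum_add_distrib, ← Finset.sum_sub_distrib]
  refine Finset.sum_congr rfl fun i _ => ?_
  rw [mul_comm 2 ((n : ℝ) - 1), ← div_div]
  have h1 := inc_mul_self i e
  have h2 := spin_mul_self (Y e)
  generalize θ / ((n : ℝ) - 1) = κ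
  linear_combination (2 * κ * spin (Y e) * spin (Y e)) * h1

/-- By `energy_flip` the two configurations that differ at `e` have log odds twice the local field,
and the mean of such a sign is a tanh. -/
theorem condMean_eq (θ : ℝ) (β : Fin n → ℝ) (e : Edge n) (Y : Config n) :
    condMean θ β e Y = Real.tanh (localField θ β e Y) := by
  have hZ := (sum_exp_pos (energy (n := n) θ β)).ne'
  have hself : Function.update Y e (Y e) = Y := Function.update_eq_self e Y
  have key : condMean θ β e Y = spin (Y e) *
      (Real.exp (energy θ β Y) - Real.exp (energy θ β (flip e Y))) /
      (Real.exp (energy θ β Y) + Real.exp (energy θ β (flip e Y))) := by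
    have hc : ∀ a b Z : ℝ, Z ≠ 0 → 0 < a → 0 < b → ∀ s : ℝ,
        (s * (a / Z) + -s * (b / Z)) / (a / Z + b / Z) = s * (a - b) / (a + b) := by
      intro a b Z hZ ha hb s
      have : a + b ≠ 0 := by positivity
      field_simp
      ring
    unfold condMean
    simp only [sum_units, pmf_eq]
    rw [← hc _ _ _ hZ (Real.exp_pos _) (Real.exp_pos _)]
    rcases Int.units_eq_one_or (Y e) with h | h
    · rw [flip, h, ← h, hself, h]
      simp only [spin_neg]
    · rw [flip, h, neg_neg, ← h, hself, h]
      simp only [spin_neg, neg_neg]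
      rw [add_comm, add_comm (Real.exp (energy θ β (Function.update Y e 1)) / _)]
  rw [key, energy_flip]
  generalize energy θ β Y = a
  generalize localField θ β e Y = x
  have hx : Real.tanh x = (Real.exp x - Real.exp (-x)) / (Real.exp x + Real.exp (-x)) := by
    rw [Real.tanh_eq_sinh_div_cosh, Real.sinh_eq, Real.cosh_eq,
      div_div_div_cancel_right₀ (by norm_num)]
  rw [hx]
  have p1 := Real.exp_pos a
  have p2 := Real.exp_pos x
  have p3 := Real.exp_pos (-x)
  have e1 : Real.exp (a - 2 * x) = Real.exp a * Real.exp (-x) * Real.exp (-x) := by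
    rw [← Real.exp_add, ← Real.exp_add]; ring_nf
  have e2 : Real.exp (a + 2 * x) = Real.exp a * Real.exp x * Real.exp x := by
    rw [← Real.exp_add, ← Real.exp_add]; ring_nf
  have e3 : Real.exp x * Real.exp (-x) = 1 := by rw [← Real.exp_add]; simp
  rcases spin_eq_one_or (Y e) with h | h <;> rw [h]
  · rw [mul_one, e1, div_eq_div_iff (by positivity) (by positivity)]
    linear_combination (-2 * Real.exp a * Real.exp (-x)) * e3
  · rw [show a - 2 * -1 * x = a + 2 * x by ring, e2,
      div_eq_div_iff (by positivity) (by positivity)]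
    linear_combination (2 * Real.exp a * Real.exp x) * e3

/-- The conditionally centered sign of the edge `e`. -/
def resid (θ : ℝ) (β : Fin n → ℝ) (e : Edge n) (Y : Config n) : ℝ :=
  spin (Y e) - Real.tanh (localField θ β e Y)

theorem abs_resid_le (θ : ℝ) (β : Fin n → ℝ) (e : Edge n) (Y : Config n) :
    |resid θ β e Y| ≤ 2 := by
  unfold resid
  refine (abs_sub _ _).trans ?_
  rw [abs_spin]
  linarith [abs_tanh_le_one (localField θ β e Y)]

/-- Within the pair formed by `Y` and its flip the residual has weighted sum zero: this is
conditional centering in pointwise form. -/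
theorem resid_mul_exp_add_flip (θ : ℝ) (β : Fin n → ℝ) (e : Edge n) (Y : Config n) :
    resid θ β e Y * Real.exp (energy θ β Y) +
      resid θ β e (flip e Y) * Real.exp (energy θ β (flip e Y)) = 0 := by
  unfold resid
  rw [localField_flip_self, energy_flip, flip_apply_self, spin_neg]
  generalize energy θ β Y = a
  generalize localField θ β e Y = x
  have hc := (Real.cosh_pos x).ne'
  have hx : Real.tanh x * Real.cosh x = Real.sinh x := by
    rw [Real.tanh_eq_sinh_div_cosh]; field_simp
  have p3 := Real.exp_pos x
  have e3 : Real.exp x * Real.exp (-x) = 1 := by rw [← Real.exp_add]; simp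
  have e1 : Real.exp (a - 2 * x) = Real.exp a * Real.exp (-x) * Real.exp (-x) := by
    rw [← Real.exp_add, ← Real.exp_add]; ring_nf
  have e2 : Real.exp (a + 2 * x) = Real.exp a * Real.exp x * Real.exp x := by
    rw [← Real.exp_add, ← Real.exp_add]; ring_nf
  rw [Real.cosh_eq, Real.sinh_eq] at hx
  rcases spin_eq_one_or (Y e) with h | h <;> rw [h]
  · rw [mul_one, e1]
    linear_combination (-2 * Real.exp a * Real.exp (-x)) * hx +
      (Real.exp a * (Real.tanh x - 1)) * e3
  · rw [show a - 2 * -1 * x = a + 2 * x by ring, e2]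
    linear_combination (-2 * Real.exp a * Real.exp x) * hx +
      (Real.exp a * (Real.tanh x + 1)) * e3

/-- Conditional centering: only the part of `G` that is odd in the edge `e` correlates with the
residual at `e`. -/
theorem gmean_resid_mul (θ : ℝ) (β : Fin n → ℝ) (e : Edge n) (G : Config n → ℝ) :
    gmean (energy θ β) (fun Y => resid θ β e Y * G Y) =
      gmean (energy θ β) (fun Y => resid θ β e Y * ((G Y - G (flip e Y)) / 2)) := by
  have hflip := Equiv.sum_comp (flipEquiv e) fun Y =>
    resid θ β e Y * (G Y + G (flip e Y)) * Real.exp (energy θ β Y)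
  have h0 : ∑ Y, resid θ β e Y * (G Y + G (flip e Y)) * Real.exp (energy θ β Y) = 0 := by
    have : ∑ Y, (resid θ β e Y * (G Y + G (flip e Y)) * Real.exp (energy θ β Y) +
        resid θ β e (flip e Y) * (G (flip e Y) + G (flip e (flip e Y))) *
          Real.exp (energy θ β (flip e Y))) = 0 := by
      refine Finset.sum_eq_zero fun Y _ => ?_
      rw [flip_flip]
      linear_combination (G Y + G (flip e Y)) * resid_mul_exp_add_flip θ β e Y
    rw [Finset.sum_add_distrib] at this
    change ∑ Y, resid θ β e (flip e Y) * (G (flip e Y) + G (flip e (flip e Y))) *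
      Real.exp (energy θ β (flip e Y)) = _ at hflip
    linarith
  unfold gmean
  congr 1
  rw [← sub_eq_zero, ← Finset.sum_sub_distrib]
  have : ∑ Y, (1 / 2 : ℝ) *
      (resid θ β e Y * (G Y + G (flip e Y)) * Real.exp (energy θ β Y)) = 0 := by
    rw [← Finset.mul_sum, h0, mul_zero]
  rw [← this]
  exact Finset.sum_congr rfl fun Y _ => by ring

/-- A flip at `e` reverses the sign of `e` itself and reaches another edge only through its local
field, by `2 * θ / (n - 1)` for each shared vertex; tanh is 1-Lipschitz. -/
theorem abs_resid_sub_flip_le {θ : ℝ} (hθ : 0 ≤ θ) (β : Fin n → ℝ) (e f : Edge n)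
    (Y : Config n) : |resid θ β f Y - resid θ β f (flip e Y)| ≤
      (if f = e then 2 else 0) + 2 * θ / ((n : ℝ) - 1) * ∑ i, inc i e * inc i f := by
  have hn : (0 : ℝ) ≤ (n : ℝ) - 1 := by
    have : 1 ≤ n := (Nat.zero_le _).trans_lt e.1.1.2
    have : (1 : ℝ) ≤ n := by exact_mod_cast this
    linarith
  have hs : 0 ≤ ∑ i, inc i e * inc i f :=
    Finset.sum_nonneg fun i _ => mul_nonneg (inc_nonneg _ _) (inc_nonneg _ _)
  by_cases h : f = e
  · subst h
    rw [if_pos rfl]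
    have h1 : resid θ β f Y - resid θ β f (flip f Y) = 2 * spin (Y f) := by
      unfold resid
      rw [localField_flip_self, flip_apply_self, spin_neg]; ring
    rw [h1, abs_mul, abs_spin, abs_of_pos two_pos, mul_one]
    exact le_add_of_nonneg_right (by positivity)
  · rw [if_neg h, zero_add]
    have h1 : resid θ β f Y - resid θ β f (flip e Y) =
        Real.tanh (localField θ β f (flip e Y)) - Real.tanh (localField θ β f Y) := by
      unfold resid
      rw [flip_apply_of_ne h]; ring
    have h2 : localField θ β f (flip e Y) - localField θ β f Y =
        -spin (Y e) * (2 * θ / ((n : ℝ) - 1) * ∑ i, inc i e * inc i f) := by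
      unfold localField
      rw [← Finset.sum_sub_distrib, Finset.mul_sum, Finset.mul_sum]
      refine Finset.sum_congr rfl fun i _ => ?_
      rw [deg_flip, flip_apply_of_ne h]
      ring
    rw [h1]
    refine (abs_tanh_sub_tanh_le _ _).trans ?_
    rw [h2, abs_mul, abs_neg, abs_spin, one_mul, abs_of_nonneg (by positivity)]

/-- Each of the two endpoints of `e` carries `n - 1` edges, so the small influences add up to `4 *
θ`, uniformly in `n` and `B`. This bounded influence replaces independence in all concentration
bounds. -/
theorem abs_sum_resid_sub_flip_le {θ : ℝ} (hθ : 0 ≤ θ) (β : Fin n → ℝ) (B : Finset (Edge n))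
    (e : Edge n) (Y : Config n) :
    |∑ f ∈ B, resid θ β f Y - ∑ f ∈ B, resid θ β f (flip e Y)| ≤ 2 + 4 * θ := by
  have hn : (0 : ℝ) < (n : ℝ) - 1 := by
    have h1 : e.1.1.val < e.1.2.val := e.2
    have h2 := e.1.2.2
    have : 2 ≤ n := by omega
    have : (2 : ℝ) ≤ n := by exact_mod_cast this
    linarith
  rw [← Finset.sum_sub_distrib]
  refine (Finset.abs_sum_le_sum_abs _ _).trans ?_
  refine (Finset.sum_le_sum_of_subset_of_nonneg (Finset.subset_univ B)
    fun _ _ _ => abs_nonneg _).trans ?_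
  refine (Finset.sum_le_sum fun f _ => abs_resid_sub_flip_le hθ β e f Y).trans (le_of_eq ?_)
  rw [Finset.sum_add_distrib, ← Finset.mul_sum, Finset.sum_comm]
  simp only [← Finset.mul_sum, sum_inc_edge, ← Finset.sum_mul, sum_inc_vertex,
    Finset.sum_ite_eq', Finset.mem_univ, if_true]
  field_simp
  ring

end Combinatorics

/-! ### Concentration of conditionally centered sums -/

section Concentration

variable {n : ℕ}

/-- Expand one factor of the square. By `gmean_resid_mul` each residual sees only the increment of
the other factor under one flip. -/
theorem gmean_sq_sum_resid_le {θ : ℝ} (hθ : 0 ≤ θ) (β : Fin n → ℝ) (B : Finset (Edge n)) :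
    gmean (energy θ β) (fun Y => (∑ f ∈ B, resid θ β f Y) ^ 2) ≤ B.card * (2 + 4 * θ) := by
  have h1 : (fun Y => (∑ f ∈ B, resid θ β f Y) ^ 2) =
      fun Y => ∑ e ∈ B, resid θ β e Y * ∑ f ∈ B, resid θ β f Y := by
    funext Y; rw [← Finset.sum_mul, sq]
  rw [h1, gmean_sum, ← nsmul_eq_mul]
  refine Finset.sum_le_card_nsmul _ _ _ fun e _ => ?_
  rw [gmean_resid_mul]
  refine (gmean_mono fun Y => ?_).trans_eq (gmean_const _ (2 + 4 * θ))
  refine (le_abs_self _).trans ?_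
  rw [abs_mul, abs_div, abs_two]
  have h2 := abs_resid_le θ β e Y
  have h3 := abs_sum_resid_sub_flip_le hθ β B e Y
  calc _ ≤ 2 * ((2 + 4 * θ) / 2) := by gcongr
    _ = 2 + 4 * θ := by ring

theorem abs_one_sub_exp_le (x : ℝ) : |1 - Real.exp x| ≤ |x| * Real.exp |x| := by
  rcases le_total 0 x with h | h
  · have h1 : 1 ≤ Real.exp x := Real.one_le_exp h
    rw [abs_of_nonpos (by linarith), abs_of_nonneg h]
    have h2 := Real.add_one_le_exp (-x)
    have h3 : Real.exp x * Real.exp (-x) = 1 := by rw [← Real.exp_add]; simp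
    nlinarith [Real.exp_pos x]
  · have h1 : Real.exp x ≤ 1 := Real.exp_le_one_iff.2 h
    rw [abs_of_nonneg (by linarith), abs_of_nonpos h]
    have h2 := Real.add_one_le_exp x
    have h3 : 1 ≤ Real.exp (-x) := Real.one_le_exp (by linarith)
    nlinarith

/-- The variance proxy per edge in the exponential moment bound. -/
def proxy (θ : ℝ) : ℝ := (2 + 4 * θ) * Real.exp (2 + 4 * θ)

/-- A differential inequality `m' ≤ M l m` for the moment generating function `m`, again by
integration by parts. The restriction `l ≤ 1` keeps the exponential of an increment bounded by a
constant. -/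
theorem gmean_sum_resid_mul_exp_le {θ l : ℝ} (hθ : 0 ≤ θ) (hl : 0 ≤ l) (hl1 : l ≤ 1)
    (β : Fin n → ℝ) (B : Finset (Edge n)) :
    gmean (energy θ β) (fun Y => (∑ f ∈ B, resid θ β f Y) *
      Real.exp (l * ∑ f ∈ B, resid θ β f Y)) ≤
      B.card * proxy θ * l *
        gmean (energy θ β) (fun Y => Real.exp (l * ∑ f ∈ B, resid θ β f Y)) := by
  simp only [Finset.sum_mul]
  rw [gmean_sum, mul_assoc, mul_assoc, ← nsmul_eq_mul]
  refine Finset.sum_le_card_nsmul _ _ _ fun e _ => ?_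
  rw [gmean_resid_mul, ← mul_assoc, ← gmean_const_mul]
  refine gmean_mono fun Y => ?_
  refine (le_abs_self _).trans ?_
  set F := ∑ f ∈ B, resid θ β f Y with hF
  set F' := ∑ f ∈ B, resid θ β f (flip e Y) with hF'
  have h2 := abs_resid_le θ β e Y
  have h3 : |F - F'| ≤ 2 + 4 * θ := abs_sum_resid_sub_flip_le hθ β B e Y
  have h4 : Real.exp (l * F) - Real.exp (l * F') =
      Real.exp (l * F) * (1 - Real.exp (l * (F' - F))) := by
    rw [mul_sub, mul_one, ← Real.exp_add]; ring_nf
  have h5 : |l * (F' - F)| ≤ l * (2 + 4 * θ) := by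
    rw [abs_mul, abs_of_nonneg hl, abs_sub_comm]; gcongr
  have h6 : |1 - Real.exp (l * (F' - F))| ≤ l * (2 + 4 * θ) * Real.exp (2 + 4 * θ) := by
    refine (abs_one_sub_exp_le _).trans ?_
    gcongr
    exact h5.trans (mul_le_of_le_one_left (by positivity) hl1)
  rw [abs_mul, abs_div, abs_two, h4, abs_mul, Real.abs_exp]
  calc _ ≤ 2 * (Real.exp (l * F) * (l * (2 + 4 * θ) * Real.exp (2 + 4 * θ)) / 2) := by gcongr
    _ = proxy θ * l * Real.exp (l * F) := by unfold proxy; ring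

theorem gmean_exp_sum_resid_le {θ l : ℝ} (hθ : 0 ≤ θ) (hl : 0 ≤ l) (hl1 : l ≤ 1)
    (β : Fin n → ℝ) (B : Finset (Edge n)) :
    gmean (energy θ β) (fun Y => Real.exp (l * ∑ f ∈ B, resid θ β f Y)) ≤
      Real.exp (B.card * proxy θ * l ^ 2 / 2) := by
  set F : Config n → ℝ := fun Y => ∑ f ∈ B, resid θ β f Y with hF
  set M : ℝ := B.card * proxy θ with hM
  have hm : ∀ u : ℝ, HasDerivAt (fun u : ℝ => gmean (energy θ β) fun Y => Real.exp (u * F Y))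
      (gmean (energy θ β) fun Y => F Y * Real.exp (u * F Y)) u := by
    intro u
    have h1 := (hasDerivAt_sum_exp (energy θ β) F u).div_const
      (∑ Y, Real.exp (energy θ β Y))
    have e1 : (fun u : ℝ => gmean (energy θ β) fun Y => Real.exp (u * F Y)) =
        fun u => (∑ Y, Real.exp (energy θ β Y + u * F Y)) / ∑ Y, Real.exp (energy θ β Y) := by
      funext u
      unfold gmean
      congr 1
      exact Finset.sum_congr rfl fun Y _ => by rw [Real.exp_add, mul_comm]
    rw [e1]
    refine h1.congr_deriv ?_
    unfold gmean
    congr 1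
    exact Finset.sum_congr rfl fun Y _ => by rw [Real.exp_add]; ring
  have hg : ∀ u : ℝ, HasDerivAt (fun u : ℝ => Real.exp (-(M * u ^ 2 / 2)))
      (Real.exp (-(M * u ^ 2 / 2)) * (-(M * u))) u := by
    intro u
    refine ((((hasDerivAt_pow 2 u).const_mul M).div_const 2).neg).exp.congr_deriv ?_
    norm_num
    ring
  have hd := fun u => (hm u).mul (hg u)
  -- Gronwall's argument: the differential inequality makes `m(u) * exp (-M u ^ 2 / 2)` decrease
  -- from its value `1` at `u = 0`.
  have hanti : AntitoneOn ((fun u : ℝ => gmean (energy θ β) fun Y => Real.exp (u * F Y)) *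
      fun u : ℝ => Real.exp (-(M * u ^ 2 / 2))) (Set.Icc 0 1) := by
    refine antitoneOn_of_deriv_nonpos (convex_Icc 0 1)
      (fun u _ => (hd u).continuousAt.continuousWithinAt)
      (fun u _ => (hd u).differentiableAt.differentiableWithinAt) fun u hu => ?_
    rw [(hd u).deriv]
    have hu' := interior_subset hu
    have := gmean_sum_resid_mul_exp_le hθ hu'.1 hu'.2 β B
    have hp := Real.exp_pos (-(M * u ^ 2 / 2))
    have : (gmean (energy θ β) fun Y => F Y * Real.exp (u * F Y)) ≤
      M * u * gmean (energy θ β) fun Y => Real.exp (u * F Y) := this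
    nlinarith
  have h := hanti (by simp) ⟨hl, hl1⟩ hl
  simp only [Pi.mul_apply] at h
  norm_num [gmean_const] at h
  rw [Real.exp_neg, ← div_eq_mul_inv, div_le_one (Real.exp_pos _)] at h
  exact h

/-- Chebyshev's inequality for conditionally centered sums. -/
theorem prob_abs_sum_resid_ge_le {θ a : ℝ} (hθ : 0 ≤ θ) (ha : 0 < a) (β : Fin n → ℝ)
    (B : Finset (Edge n)) :
    prob θ β {Y | a ≤ |∑ f ∈ B, resid θ β f Y|} ≤ B.card * (2 + 4 * θ) / a ^ 2 := by
  refine (prob_le_gmean θ β (G := fun Y => (∑ f ∈ B, resid θ β f Y) ^ 2 * (1 / a ^ 2))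
    (fun Y => by positivity) fun Y hY => ?_).trans ?_
  · rw [mul_one_div, one_le_div (by positivity), ← sq_abs (∑ f ∈ B, resid θ β f Y)]
    exact pow_le_pow_left₀ ha.le hY 2
  · rw [gmean_mul_const, mul_one_div]
    gcongr
    exact gmean_sq_sum_resid_le hθ β B

theorem prob_mono (θ : ℝ) (β : Fin n → ℝ) {S T : Set (Config n)} (h : S ⊆ T) :
    prob θ β S ≤ prob θ β T := by
  classical
  rw [prob_eq_gmean θ β T]
  refine prob_le_gmean θ β (fun Y => by split_ifs <;> norm_num) fun Y hY => ?_
  rw [if_pos (h hY)]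

/-! ### The shift of the residuals under an alternative -/

/-- The gain in conditional mean of the edge `e` when `β₀` is replaced by `β`. -/
def shift (θ β₀ : ℝ) (β : Fin n → ℝ) (e : Edge n) (Y : Config n) : ℝ :=
  Real.tanh (localField θ β e Y) - Real.tanh (localField θ (fun _ => β₀) e Y)

/-- Under the alternative the first term is centered and concentrates, while the second is a drift
with a deterministic lower bound. -/
theorem resid_null_eq (θ β₀ : ℝ) (β : Fin n → ℝ) (e : Edge n) (Y : Config n) :
    resid θ (fun _ => β₀) e Y = resid θ β e Y + shift θ β₀ β e Y := by
  unfold resid shift; ring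

theorem abs_deg_le (Y : Config n) (i : Fin n) : |deg Y i| ≤ (n : ℝ) - 1 := by
  rw [deg_eq_lin, lin, ← sum_inc_edge i]
  refine (Finset.abs_sum_le_sum_abs _ _).trans (le_of_eq ?_)
  simp only [abs_mul, abs_spin, mul_one, abs_of_nonneg (inc_nonneg _ _)]

theorem two_le_of_edge (e : Edge n) : (2 : ℝ) ≤ n := by
  have h1 : e.1.1.val < e.1.2.val := e.2
  have h2 := e.1.2.2
  have : 2 ≤ n := by omega
  exact_mod_cast this

theorem abs_localField_le {θ : ℝ} (hθ : 0 ≤ θ) (β₀ : ℝ) (e : Edge n) (Y : Config n) :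
    |localField θ (fun _ => β₀) e Y| ≤ 4 * θ + |β₀| := by
  have hn := two_le_of_edge e
  have hn1 : (0 : ℝ) < (n : ℝ) - 1 := by linarith
  have h : ∀ i, |inc i e * (θ / ((n : ℝ) - 1) * (deg Y i - spin (Y e)) + β₀ / 2)| ≤
      inc i e * (2 * θ + |β₀| / 2) := by
    intro i
    rw [abs_mul, abs_of_nonneg (inc_nonneg i e)]
    refine mul_le_mul_of_nonneg_left ?_ (inc_nonneg i e)
    refine (abs_add_le _ _).trans ?_
    rw [abs_mul, abs_of_nonneg (by positivity : 0 ≤ θ / ((n : ℝ) - 1)), abs_div, abs_two]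
    have h1 : |deg Y i - spin (Y e)| ≤ 2 * ((n : ℝ) - 1) := by
      refine (abs_sub _ _).trans ?_
      rw [abs_spin]
      linarith [abs_deg_le Y i]
    have h2 : θ / ((n : ℝ) - 1) * |deg Y i - spin (Y e)| ≤
        θ / ((n : ℝ) - 1) * (2 * ((n : ℝ) - 1)) := by gcongr
    have h3 : θ / ((n : ℝ) - 1) * (2 * ((n : ℝ) - 1)) = 2 * θ := by field_simp
    linarith
  refine (Finset.abs_sum_le_sum_abs _ _).trans ((Finset.sum_le_sum fun i _ => h i).trans ?_)
  rw [← Finset.sum_mul, sum_inc_vertex]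
  linarith

/-- The constant in the lower bound for the shift. -/
def gain (θ β₀ : ℝ) : ℝ := 1 / (2 * Real.cosh (4 * θ + |β₀| + 1) ^ 2)

theorem gain_pos (θ β₀ : ℝ) : 0 < gain θ β₀ := by
  have := Real.cosh_pos (4 * θ + |β₀| + 1)
  unfold gain; positivity

theorem localField_add (θ β₀ : ℝ) {β μ : Fin n → ℝ} (hβ : ∀ i, β i = β₀ + μ i) (e : Edge n)
    (Y : Config n) :
    localField θ β e Y = localField θ (fun _ => β₀) e Y + (∑ i, inc i e * μ i) / 2 := by
  unfold localField
  rw [Finset.sum_div, ← Finset.sum_add_distrib]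
  exact Finset.sum_congr rfl fun i _ => by rw [hβ]; ring

theorem shift_nonneg (θ β₀ : ℝ) {β μ : Fin n → ℝ} (hβ : ∀ i, β i = β₀ + μ i)
    (hμ : ∀ i, 0 ≤ μ i) (e : Edge n) (Y : Config n) : 0 ≤ shift θ β₀ β e Y := by
  unfold shift
  rw [sub_nonneg, localField_add θ β₀ hβ]
  refine monotone_tanh_and_monotone_id_sub_tanh.1 (le_add_of_nonneg_right ?_)
  exact div_nonneg (Finset.sum_nonneg fun i _ => mul_nonneg (inc_nonneg i e) (hμ i)) two_pos.le

theorem le_shift {θ A : ℝ} (hθ : 0 ≤ θ) (β₀ : ℝ) (hA : 0 ≤ A) (hA1 : A ≤ 1)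
    {β μ : Fin n → ℝ} (hβ : ∀ i, β i = β₀ + μ i) (hμ : ∀ i, 0 ≤ μ i) {i : Fin n}
    (hi : A ≤ μ i) {e : Edge n} (he : e.1.1 = i ∨ e.1.2 = i) (Y : Config n) :
    gain θ β₀ * A ≤ shift θ β₀ β e Y := by
  have h1 : A / 2 ≤ (∑ i, inc i e * μ i) / 2 := by
    have := Finset.single_le_sum (f := fun i => inc i e * μ i)
      (fun i _ => mul_nonneg (inc_nonneg i e) (hμ i)) (Finset.mem_univ i)
    have h2 : inc i e = 1 := if_pos he
    simp only [h2, one_mul] at this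
    linarith
  have := le_tanh_add_sub_tanh (abs_localField_le hθ β₀ e Y) (by linarith : 0 ≤ A / 2)
    (by linarith) h1
  rw [shift, localField_add θ β₀ hβ]
  refine le_trans (le_of_eq ?_) this
  unfold gain
  ring

/-- Type II error of a test based on a conditionally centered sum. -/
theorem prob_sum_resid_null_le {θ : ℝ} (hθ : 0 ≤ θ) (β₀ : ℝ) (β : Fin n → ℝ)
    (B : Finset (Edge n)) {L Δ : ℝ} (hΔ : 0 < Δ) (hL : L ≤ Δ / 2)
    (hs : ∀ Y, Δ ≤ ∑ e ∈ B, shift θ β₀ β e Y) :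
    prob θ β {Y | ∑ e ∈ B, resid θ (fun _ => β₀) e Y ≤ L} ≤
      B.card * (2 + 4 * θ) / (Δ / 2) ^ 2 := by
  refine le_trans (prob_mono θ β fun Y hY => ?_)
    (prob_abs_sum_resid_ge_le hθ (half_pos hΔ) β B)
  simp only [Set.mem_ofPred_eq, resid_null_eq θ β₀ β, Finset.sum_add_distrib] at hY ⊢
  rw [le_abs]
  right
  linarith [hs Y]

end Concentration

/-! ### Power of the conditionally centered tests -/

section Power

variable {n : ℕ}

theorem risk_nonneg (θ β₀ s A : ℝ) (T : Test n) : 0 ≤ risk θ β₀ s A T :=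
  add_nonneg (prob_nonneg _ _ _) (Real.iSup_nonneg fun _ => prob_nonneg _ _ _)

theorem risk_le {θ β₀ s A x y : ℝ} {T : Test n} (hy : 0 ≤ y)
    (h1 : prob θ (fun _ => β₀) {Y | T Y = 1} ≤ x)
    (h2 : ∀ β ∈ alternatives n β₀ s A, prob θ β {Y | T Y = 0} ≤ y) :
    risk θ β₀ s A T ≤ x + y :=
  add_le_add h1 (Real.iSup_le (fun β => h2 β.1 β.2) hy)

theorem card_edge_le : (Fintype.card (Edge n) : ℝ) ≤ (n : ℝ) ^ 2 := by
  have h := Fintype.card_subtype_le fun e : Fin n × Fin n => e.1 < e.2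
  rw [Fintype.card_prod, Fintype.card_fin, ← sq] at h
  exact_mod_cast h

theorem nonneg_of_support {A : ℝ} {μ : Fin n → ℝ} (hA : 0 ≤ A)
    (h : ∀ i ∈ Function.support μ, A ≤ μ i) (i : Fin n) : 0 ≤ μ i := by
  by_cases hi : μ i = 0
  · exact hi.ge
  · exact hA.trans (h i hi)

/-! ### The conditionally centered sum test. -/

theorem sumTest_eq_one_iff {θ β₀ L : ℝ} {Y : Config n} :
    sumTest n θ β₀ L Y = 1 ↔ L < ∑ e, resid θ (fun _ => β₀) e Y := by
  simp only [sumTest, condMean_eq]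
  change (if L < ∑ e, resid θ (fun _ => β₀) e Y then (1 : Fin 2) else 0) = 1 ↔ _
  by_cases h : L < ∑ e, resid θ (fun _ => β₀) e Y <;> simp [h]

theorem sumTest_eq_zero_iff {θ β₀ L : ℝ} {Y : Config n} :
    sumTest n θ β₀ L Y = 0 ↔ ∑ e, resid θ (fun _ => β₀) e Y ≤ L := by
  simp only [sumTest, condMean_eq]
  change (if L < ∑ e, resid θ (fun _ => β₀) e Y then (1 : Fin 2) else 0) = 0 ↔ _
  rw [← not_lt]
  by_cases h : L < ∑ e, resid θ (fun _ => β₀) e Y <;> simp [h]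

theorem le_sum_shift {θ A s : ℝ} (hθ : 0 ≤ θ) (β₀ : ℝ) (hA : 0 ≤ A) (hA1 : A ≤ 1)
    (hn : 1 ≤ (n : ℝ)) {β : Fin n → ℝ} (hβ : β ∈ alternatives n β₀ s A) (Y : Config n) :
    gain θ β₀ * A / 2 * (s * ((n : ℝ) - 1)) ≤ ∑ e, shift θ β₀ β e Y := by
  classical
  obtain ⟨μ, hβ, hs, hμ⟩ := hβ
  have hμ0 := nonneg_of_support hA hμ
  have hg := gain_pos θ β₀
  set S := Finset.univ.filter fun i => μ i ≠ 0 with hS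
  have hcard : s ≤ (S.card : ℝ) := by
    have : (Function.support μ).ncard = S.card := by
      rw [← Set.ncard_coe_finset]
      congr 1
      ext i
      simp [hS]
    rwa [this] at hs
  -- An edge has at most two endpoints in the support. Charging half of its drift to each of them
  -- turns the sum over edges into a sum over the raised vertices, each with `n - 1` edges.
  have h1 : ∀ e, gain θ β₀ * A / 2 * ∑ i ∈ S, inc i e ≤ shift θ β₀ β e Y := by
    intro e
    by_cases h : ∃ i ∈ S, e.1.1 = i ∨ e.1.2 = i
    · obtain ⟨i, hi, he⟩ := h
      have h2 := le_shift hθ β₀ hA hA1 hβ hμ0 (hμ i (by simpa [hS] using hi)) he Y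
      have h3 : ∑ i ∈ S, inc i e ≤ 2 := by
        rw [← sum_inc_vertex e]
        exact Finset.sum_le_sum_of_subset_of_nonneg (Finset.subset_univ _)
          fun i _ _ => inc_nonneg i e
      have h4 : gain θ β₀ * A / 2 * ∑ i ∈ S, inc i e ≤ gain θ β₀ * A / 2 * 2 := by gcongr
      linarith
    · push Not at h
      have h0 : ∑ i ∈ S, inc i e = 0 :=
        Finset.sum_eq_zero fun i hi => if_neg (not_or.2 (h i hi))
      rw [h0, mul_zero]
      exact shift_nonneg θ β₀ hβ hμ0 e Y
  refine le_trans ?_ (Finset.sum_le_sum fun e _ => h1 e)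
  rw [← Finset.mul_sum, Finset.sum_comm]
  simp only [sum_inc_edge, Finset.sum_const, nsmul_eq_mul]
  have : (0 : ℝ) ≤ (n : ℝ) - 1 := by linarith
  gcongr

theorem risk_sumTest_le {θ A s L : ℝ} (hθ : 0 ≤ θ) (β₀ : ℝ) (hA : 0 < A) (hA1 : A ≤ 1)
    (hs : 0 < s) (hn : 2 ≤ (n : ℝ)) (hL : 0 < L)
    (hL' : L ≤ gain θ β₀ / 8 * (n * s * A)) :
    risk θ β₀ s A (sumTest n θ β₀ L) ≤
      (n : ℝ) ^ 2 * (2 + 4 * θ) / L ^ 2 +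
        (n : ℝ) ^ 2 * (2 + 4 * θ) / (gain θ β₀ / 8 * (n * s * A)) ^ 2 := by
  have hg := gain_pos θ β₀
  have hcard := card_edge_le (n := n)
  refine risk_le (by positivity) ?_ fun β hβ => ?_
  · have h1 : {Y : Config n | sumTest n θ β₀ L Y = 1} ⊆
        {Y | L ≤ |∑ e, resid θ (fun _ => β₀) e Y|} := fun Y hY =>
      (sumTest_eq_one_iff.1 hY).le.trans (le_abs_self _)
    refine (prob_mono _ _ h1).trans ((prob_abs_sum_resid_ge_le hθ hL _ _).trans ?_)
    rw [Finset.card_univ]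
    gcongr
  · have h1 : {Y : Config n | sumTest n θ β₀ L Y = 0} ⊆
        {Y | ∑ e, resid θ (fun _ => β₀) e Y ≤ L} := fun Y hY => sumTest_eq_zero_iff.1 hY
    have hsh : ∀ Y, gain θ β₀ / 4 * (n * s * A) ≤ ∑ e, shift θ β₀ β e Y := by
      intro Y
      refine le_trans ?_ (le_sum_shift hθ β₀ hA.le hA1 (by linarith) hβ Y)
      have : 0 ≤ gain θ β₀ * A * s := by positivity
      nlinarith
    have h2 := prob_sum_resid_null_le hθ β₀ β Finset.univ
      (Δ := gain θ β₀ / 4 * (n * s * A)) (L := L) (by positivity) (by linarith) hsh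
    refine (prob_mono _ _ h1).trans (h2.trans ?_)
    rw [Finset.card_univ, show gain θ β₀ / 4 * (n * s * A) / 2 =
      gain θ β₀ / 8 * (n * s * A) by ring]
    gcongr

/-- The edges at a vertex. -/
def star (i : Fin n) : Finset (Edge n) :=
  Finset.univ.filter fun e => e.1.1 = i ∨ e.1.2 = i

theorem card_star (i : Fin n) : ((star i).card : ℝ) = (n : ℝ) - 1 := by
  rw [← sum_inc_edge i]
  simp [star, inc]

theorem centeredDeg_eq (θ β₀ : ℝ) (i : Fin n) (Y : Config n) :
    centeredDeg θ β₀ i Y = ∑ e ∈ star i, resid θ (fun _ => β₀) e Y := by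
  simp only [centeredDeg, condMean_eq, resid, star]

/-- Type I error of the maximum test. -/
theorem prob_maxTest_eq_one_le {θ l : ℝ} (hθ : 0 ≤ θ) (β₀ L : ℝ) (hl : 0 ≤ l) (hl1 : l ≤ 1)
    (hn : 1 ≤ n) :
    prob θ (fun _ => β₀) {Y : Config n | maxTest n θ β₀ L Y = 1} ≤
      n * Real.exp (n * proxy θ * l ^ 2 / 2 - l * L) := by
  have hne : Nonempty (Fin n) := ⟨⟨0, hn⟩⟩
  have hp : 0 ≤ proxy θ := by unfold proxy; positivity
  -- Union bound over the vertices combined with the exponential Markov inequality.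
  refine (prob_le_gmean θ _ (G := fun Y => ∑ i : Fin n,
    Real.exp (-(l * L)) * Real.exp (l * ∑ e ∈ star i, resid θ (fun _ => β₀) e Y))
    (fun Y => by positivity) fun Y hY => ?_).trans ?_
  · have hY : maxTest n θ β₀ L Y = 1 := hY
    have h1 : L < ⨆ i : Fin n, centeredDeg θ β₀ i Y := by
      by_contra h
      simp [maxTest, h] at hY
    obtain ⟨i, hi⟩ := exists_lt_of_lt_ciSup h1
    rw [centeredDeg_eq] at hi
    refine le_trans ?_ (Finset.single_le_sum (f := fun i : Fin n =>
      Real.exp (-(l * L)) * Real.exp (l * ∑ e ∈ star i, resid θ (fun _ => β₀) e Y))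
      (fun i _ => by positivity) (Finset.mem_univ i))
    rw [← Real.exp_add]
    refine Real.one_le_exp ?_
    nlinarith
  · rw [gmean_sum]
    have h1 : ∀ i : Fin n, gmean (energy θ fun _ => β₀) (fun Y => Real.exp (-(l * L)) *
        Real.exp (l * ∑ e ∈ star i, resid θ (fun _ => β₀) e Y)) ≤
        Real.exp (n * proxy θ * l ^ 2 / 2 - l * L) := by
      intro i
      rw [gmean_const_mul, sub_eq_add_neg, add_comm, Real.exp_add]
      gcongr
      refine (gmean_exp_sum_resid_le hθ hl hl1 _ _).trans ?_
      rw [card_star]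
      gcongr
      linarith
    refine (Finset.sum_le_sum fun i _ => h1 i).trans (le_of_eq ?_)
    simp

/-- For the type II error one raised vertex suffices: the drift over its star is of order `n * A`,
and Chebyshev's inequality applies to that single star. The bound `0 < s` guarantees such a vertex.
-/
theorem risk_maxTest_le {θ A s L l : ℝ} (hθ : 0 ≤ θ) (β₀ : ℝ) (hA : 0 < A) (hA1 : A ≤ 1)
    (hs : 0 < s) (hn : 2 ≤ (n : ℝ)) (hl : 0 ≤ l) (hl1 : l ≤ 1)
    (hL' : L ≤ gain θ β₀ / 4 * (n * A)) :
    risk θ β₀ s A (maxTest n θ β₀ L) ≤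
      n * Real.exp (n * proxy θ * l ^ 2 / 2 - l * L) +
        (n : ℝ) * (2 + 4 * θ) / (gain θ β₀ / 4 * (n * A)) ^ 2 := by
  have hg := gain_pos θ β₀
  refine risk_le (by positivity)
    (prob_maxTest_eq_one_le hθ β₀ L hl hl1 (by
      have : (1 : ℝ) ≤ n := by linarith
      exact_mod_cast this)) fun β hβ => ?_
  obtain ⟨μ, hβ, hsupp, hμ⟩ := hβ
  have hμ0 := nonneg_of_support hA.le hμ
  obtain ⟨i, hi⟩ : (Function.support μ).Nonempty := by
    rw [Set.nonempty_iff_ne_empty]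
    intro h
    rw [h, Set.ncard_empty] at hsupp
    norm_num at hsupp
    linarith
  have h1 : {Y : Config n | maxTest n θ β₀ L Y = 0} ⊆
      {Y | ∑ e ∈ star i, resid θ (fun _ => β₀) e Y ≤ L} := by
    intro Y hY
    have hY : maxTest n θ β₀ L Y = 0 := hY
    have h2 : ¬ L < ⨆ i : Fin n, centeredDeg θ β₀ i Y := by
      intro h
      simp [maxTest, h] at hY
    change ∑ e ∈ star i, resid θ (fun _ => β₀) e Y ≤ L
    rw [← centeredDeg_eq]
    exact (le_ciSup (Finite.bddAbove_range _) i).trans (not_lt.1 h2)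
  have hsh : ∀ Y, gain θ β₀ / 2 * (n * A) ≤ ∑ e ∈ star i, shift θ β₀ β e Y := by
    intro Y
    have h3 := Finset.card_nsmul_le_sum (star i) (fun e => shift θ β₀ β e Y) (gain θ β₀ * A)
      fun e he => le_shift hθ β₀ hA.le hA1 hβ hμ0 (hμ i hi) (by simpa [star] using he) Y
    rw [nsmul_eq_mul, card_star] at h3
    refine le_trans ?_ h3
    have : 0 ≤ gain θ β₀ * A := by positivity
    nlinarith
  have h2 := prob_sum_resid_null_le hθ β₀ β (star i)
    (Δ := gain θ β₀ / 2 * (n * A)) (L := L) (by positivity) (by linarith) hsh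
  refine (prob_mono _ _ h1).trans (h2.trans ?_)
  rw [card_star, show gain θ β₀ / 2 * (n * A) / 2 = gain θ β₀ / 4 * (n * A) by ring]
  gcongr
  linarith

/-! ### From risk bounds to asymptotic power. -/

theorem tendsto_natCast_rpow_neg {p : ℝ} (hp : p < 0) :
    Tendsto (fun n : ℕ => (n : ℝ) ^ p) atTop (𝓝 0) := by
  have := (tendsto_rpow_neg_atTop (by linarith : 0 < -p)).comp tendsto_natCast_atTop_atTop
  simpa [Function.comp_def] using this

/-- The type I bound is of order `(n / L) ^ 2` and the type II bound of order `n ^ (-2 (b + t))`.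
The second condition on `L` keeps the cut-off below half the drift. -/
theorem asympPowerful_sumTest {θ : ℝ} (hθ : 0 ≤ θ) (β₀ : ℝ) {b t : ℝ} (ht : t < 0)
    (hbt : 0 < b + t) {L : ℕ → ℝ} (hL : Tendsto (fun n : ℕ => L n / (n : ℝ)) atTop atTop)
    (hL' : Tendsto (fun n : ℕ => L n / ((n : ℝ) * (n : ℝ) ^ b * (n : ℝ) ^ t)) atTop (𝓝 0)) :
    AsympPowerful θ β₀ (fun n => (n : ℝ) ^ b) (fun n => (n : ℝ) ^ t)
      (fun n => sumTest n θ β₀ (L n)) := by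
  have hg := gain_pos θ β₀
  have hlim : Tendsto (fun n : ℕ => (2 + 4 * θ) * ((L n / (n : ℝ))⁻¹) ^ 2 +
      (2 + 4 * θ) * ((gain θ β₀ / 8)⁻¹ * (n : ℝ) ^ (-(b + t))) ^ 2) atTop (𝓝 0) := by
    have h1 := (hL.inv_tendsto_atTop.pow 2).const_mul (2 + 4 * θ)
    have h2 := (((tendsto_natCast_rpow_neg (neg_neg_of_pos hbt)).const_mul
      (gain θ β₀ / 8)⁻¹).pow 2).const_mul (2 + 4 * θ)
    simpa using h1.add h2
  refine squeeze_zero' (Eventually.of_forall fun n => risk_nonneg _ _ _ _ _) ?_ hlim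
  filter_upwards [eventually_ge_atTop 2, hL.eventually_gt_atTop 0,
    hL'.eventually_le_const (by positivity : 0 < gain θ β₀ / 8)] with n hn hL0 hL1
  have hn2 : (2 : ℝ) ≤ n := by exact_mod_cast hn
  have hn0 : (0 : ℝ) < n := by linarith
  have hpb := Real.rpow_pos_of_pos hn0 b
  have hpt := Real.rpow_pos_of_pos hn0 t
  have hLpos : 0 < L n := by
    rcases div_pos_iff.1 hL0 with h | h
    · exact h.1
    · linarith [h.2]
  rw [div_le_iff₀ (by positivity)] at hL1
  refine (risk_sumTest_le hθ β₀ hpt (Real.rpow_le_one_of_one_le_of_nonpos (by linarith) ht.le)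
    hpb hn2 hLpos hL1).trans (le_of_eq ?_)
  rw [Real.rpow_neg hn0.le, Real.rpow_add hn0]
  field_simp

theorem asympPowerful_maxTest {θ : ℝ} (hθ : 0 ≤ θ) (β₀ : ℝ) {b t : ℝ} (ht : t < 0)
    (ht' : 0 < t + 1 / 2) :
    AsympPowerful θ β₀ (fun n => (n : ℝ) ^ b) (fun n => (n : ℝ) ^ t)
      (fun n => maxTest n θ β₀ ((proxy θ / 2 + 2) * Real.sqrt ((n : ℝ) * Real.log n))) := by
  have hg := gain_pos θ β₀
  have hp : 0 ≤ proxy θ := by unfold proxy; positivity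
  set C := proxy θ / 2 + 2 with hC
  have hCpos : 0 < C := by positivity
  have hlim : Tendsto (fun n : ℕ => ((n : ℝ))⁻¹ + (2 + 4 * θ) * ((gain θ β₀ / 4)⁻¹) ^ 2 *
      (n : ℝ) ^ (-(1 + 2 * t))) atTop (𝓝 0) := by
    have h1 := tendsto_inv_atTop_zero.comp (tendsto_natCast_atTop_atTop (R := ℝ))
    have h2 := (tendsto_natCast_rpow_neg (by linarith : -(1 + 2 * t) < 0)).const_mul
      ((2 + 4 * θ) * ((gain θ β₀ / 4)⁻¹) ^ 2)
    simpa using h1.add h2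
  refine squeeze_zero' (Eventually.of_forall fun n => risk_nonneg _ _ _ _ _) ?_ hlim
  -- As `1 + 2 * t > 0`, `log n` is negligible against `n * A ^ 2`. Squared, this puts the cut-off
  -- below half the drift of a raised star.
  have hlog := ((isLittleO_log_rpow_atTop (by linarith : 0 < 1 + 2 * t)).comp_tendsto
    (tendsto_natCast_atTop_atTop (R := ℝ))).def (by positivity : 0 < (gain θ β₀ / 4 / C) ^ 2)
  filter_upwards [eventually_ge_atTop 2, hlog] with n hn hlog
  have hn2 : (2 : ℝ) ≤ n := by exact_mod_cast hn
  have hn0 : (0 : ℝ) < n := by linarith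
  have hpb := Real.rpow_pos_of_pos hn0 b
  have hpt := Real.rpow_pos_of_pos hn0 t
  have hlog0 : 0 ≤ Real.log n := Real.log_nonneg (by linarith)
  have hrpow : (n : ℝ) ^ (1 + 2 * t) = n * ((n : ℝ) ^ t) ^ 2 := by
    rw [Real.rpow_add hn0, Real.rpow_one, mul_comm 2 t, Real.rpow_mul hn0.le, Real.rpow_two]
  simp only [Function.comp_apply, Real.norm_eq_abs, abs_of_nonneg hlog0, hrpow] at hlog
  rw [abs_of_nonneg (by positivity)] at hlog
  have hL : C * Real.sqrt ((n : ℝ) * Real.log n) ≤ gain θ β₀ / 4 * (n * (n : ℝ) ^ t) := by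
    have h1 : Real.sqrt ((n : ℝ) * Real.log n) ≤ gain θ β₀ / 4 / C * (n * (n : ℝ) ^ t) := by
      refine Real.sqrt_le_iff.2 ⟨by positivity, ?_⟩
      calc (n : ℝ) * Real.log n ≤ n * ((gain θ β₀ / 4 / C) ^ 2 * (n * ((n : ℝ) ^ t) ^ 2)) := by
            gcongr
        _ = _ := by ring
    calc _ ≤ C * (gain θ β₀ / 4 / C * (n * (n : ℝ) ^ t)) := by gcongr
      _ = _ := by field_simp
  have hl1 : Real.sqrt (Real.log n / n) ≤ 1 := by
    rw [Real.sqrt_le_one, div_le_one hn0]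
    exact (Real.log_le_sub_one_of_pos hn0).trans (by linarith)
  -- With `l = √(log n / n)` the exponent is `(proxy θ / 2 - C) * log n = -2 * log n`, which beats
  -- the factor `n` of the union bound. This fixes `C`.
  refine (risk_maxTest_le hθ β₀ hpt (Real.rpow_le_one_of_one_le_of_nonpos (by linarith) ht.le)
    hpb hn2 (Real.sqrt_nonneg (Real.log n / n)) hl1 hL).trans (le_of_eq ?_)
  have e1 : Real.sqrt (Real.log n / n) * (C * Real.sqrt (n * Real.log n)) = C * Real.log n := by
    rw [mul_left_comm, ← Real.sqrt_mul (by positivity)]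
    rw [show Real.log n / n * (n * Real.log n) = Real.log n * Real.log n by field_simp,
      Real.sqrt_mul_self hlog0]
  rw [e1, Real.sq_sqrt (by positivity)]
  congr 1
  · rw [show (n : ℝ) * proxy θ * (Real.log n / n) / 2 - C * Real.log n = -Real.log n + -Real.log n
      by rw [hC]; field_simp; ring, Real.exp_add, Real.exp_neg, Real.exp_log hn0]
    field_simp
  · rw [Real.rpow_neg hn0.le, hrpow]
    field_simp

end Power

/-! ### Covariances of the degrees -/

section Covariance

variable {n : ℕ}

/-- The linear combination of the degrees with coefficients `w`. -/
def wdeg (w : Fin n → ℝ) (Y : Config n) : ℝ := ∑ i, w i * deg Y i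

theorem wdeg_eq_lin (w : Fin n → ℝ) (Y : Config n) :
    wdeg w Y = lin (fun e => ∑ i, w i * inc i e) Y := by
  unfold wdeg lin
  simp only [deg_eq_lin, lin, Finset.mul_sum, Finset.sum_mul]
  rw [Finset.sum_comm]
  simp only [mul_assoc]

theorem wdeg_const_mul (c : ℝ) (w : Fin n → ℝ) (Y : Config n) :
    wdeg (fun i => c * w i) Y = c * wdeg w Y := by
  simp only [wdeg, Finset.mul_sum, mul_assoc]

theorem energy_add (θ : ℝ) (β μ : Fin n → ℝ) (t : ℝ) (Y : Config n) :
    energy θ (fun i => β i + t * μ i) Y = energy θ β Y + t * (1 / 2 * wdeg μ Y) := by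
  simp only [energy, wdeg, add_mul, Finset.sum_add_distrib, mul_assoc, ← Finset.mul_sum]
  ring

theorem coupling_nonneg {θ : ℝ} (hθ : 0 ≤ θ) (hn : 1 ≤ n) : 0 ≤ θ / (2 * ((n : ℝ) - 1)) := by
  have : (1 : ℝ) ≤ n := by exact_mod_cast hn
  exact div_nonneg hθ (by linarith)

theorem energy_eq_ferro {θ : ℝ} (hθ : 0 ≤ θ) (hn : 1 ≤ n) (β : Fin n → ℝ) :
    energy θ β = ferro (fun i e => Real.sqrt (θ / (2 * ((n : ℝ) - 1))) * inc i e)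
      (fun e => ∑ i, (1 / 2 * β i) * inc i e) := by
  funext Y
  unfold energy ferro
  rw [← wdeg_eq_lin, wdeg_const_mul, Finset.mul_sum]
  congr 1
  refine Finset.sum_congr rfl fun i _ => ?_
  have : lin (fun e => Real.sqrt (θ / (2 * ((n : ℝ) - 1))) * inc i e) Y =
      Real.sqrt (θ / (2 * ((n : ℝ) - 1))) * deg Y i := by
    rw [deg_eq_lin]
    simp only [lin, Finset.mul_sum, mul_assoc]
  rw [this, mul_pow, Real.sq_sqrt (coupling_nonneg hθ hn)]

theorem gcum_wdeg_nonpos {θ : ℝ} (hθ : 0 ≤ θ) (hn : 1 ≤ n) {β u v w : Fin n → ℝ}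
    (hβ : ∀ i, 0 ≤ β i) (hu : ∀ i, 0 ≤ u i) (hv : ∀ i, 0 ≤ v i) (hw : ∀ i, 0 ≤ w i) :
    gcum (energy θ β) (wdeg u) (wdeg v) (wdeg w) ≤ 0 := by
  have h : ∀ w : Fin n → ℝ, (∀ i, 0 ≤ w i) → ∀ e : Edge n, 0 ≤ ∑ i, w i * inc i e :=
    fun w hw e => Finset.sum_nonneg fun i _ => mul_nonneg (hw i) (inc_nonneg i e)
  have e : ∀ w : Fin n → ℝ, wdeg w = lin (fun e => ∑ i, w i * inc i e) :=
    fun w => funext fun Y => wdeg_eq_lin w Y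
  rw [energy_eq_ferro hθ hn, e, e, e]
  exact gcum_ferro_nonpos (fun i e => mul_nonneg (Real.sqrt_nonneg _) (inc_nonneg i e))
    (h _ fun i => mul_nonneg (by norm_num) (hβ i)) (h _ hu) (h _ hv) (h _ hw)

/-- Covariances of nonnegative combinations of the degrees decrease in nonnegative fields. -/
theorem gcov_wdeg_anti {θ : ℝ} (hθ : 0 ≤ θ) (hn : 1 ≤ n) {ρ β u v : Fin n → ℝ}
    (hρ : ∀ i, 0 ≤ ρ i) (hβ : ∀ i, ρ i ≤ β i) (hu : ∀ i, 0 ≤ u i) (hv : ∀ i, 0 ≤ v i) :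
    gcov (energy θ β) (wdeg u) (wdeg v) ≤ gcov (energy θ ρ) (wdeg u) (wdeg v) := by
  have e1 : ∀ t : ℝ, (fun Y => energy θ ρ Y + t * wdeg (fun i => 1 / 2 * (β i - ρ i)) Y) =
      energy θ (fun i => ρ i + t * (β i - ρ i)) := by
    intro t
    funext Y
    rw [energy_add, wdeg_const_mul]
  -- The derivative along the segment from `ρ` to `β` is a third cumulant in nonnegative fields,
  -- hence nonpositive by GHS.
  have h := sub_le_of_hasDerivAt_le (C := 0)
    (hasDerivAt_gcov (energy θ ρ) (wdeg fun i => 1 / 2 * (β i - ρ i)) (wdeg u) (wdeg v))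
    fun t ht => by
      rw [e1]
      exact gcum_wdeg_nonpos hθ hn
        (fun i => add_nonneg (hρ i) (mul_nonneg ht.1 (sub_nonneg.2 (hβ i)))) hu hv
        fun i => mul_nonneg (by norm_num) (sub_nonneg.2 (hβ i))
  simp only [e1] at h
  simp only [one_mul, zero_mul, add_zero, add_sub_cancel] at h
  linarith

theorem deg_neg (Y : Config n) (i : Fin n) : deg (-Y) i = -deg Y i := by
  simp only [deg_eq_lin, lin, Pi.neg_apply, spin_neg, mul_neg, Finset.sum_neg_distrib]

/-- Reversing all the fields does not change the covariances of the degrees. -/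
theorem gcov_wdeg_neg (θ : ℝ) (β u v : Fin n → ℝ) :
    gcov (energy θ fun i => -β i) (wdeg u) (wdeg v) = gcov (energy θ β) (wdeg u) (wdeg v) := by
  rw [← gcov_comp_equiv (Equiv.neg (Config n)) (energy θ β)]
  have e1 : (fun Y : Config n => energy θ β (Equiv.neg (Config n) Y)) =
      energy θ fun i => -β i := by
    funext Y
    simp only [Equiv.neg_apply, energy, deg_neg, neg_sq, neg_mul, mul_neg]
  have e2 : ∀ w : Fin n → ℝ, (fun Y : Config n => wdeg w (Equiv.neg (Config n) Y)) =
      fun Y => (-1) * wdeg w Y := by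
    intro w
    funext Y
    simp only [Equiv.neg_apply, wdeg, deg_neg, mul_neg, Finset.sum_neg_distrib, neg_mul, one_mul]
  rw [e1, e2, e2, gcov_const_mul_left, gcov_const_mul_right]
  ring

/-! ### Positive association -/

theorem spin_mono : Monotone spin := by
  intro u v h
  have : (u : ℤ) ≤ (v : ℤ) := h
  unfold spin
  exact_mod_cast this

theorem spin_inf_add_sup (u v : ℤˣ) : spin (u ⊓ v) + spin (u ⊔ v) = spin u + spin v := by
  rcases le_total u v with h | h
  · rw [inf_eq_left.2 h, sup_eq_right.2 h]
  · rw [inf_eq_right.2 h, sup_eq_left.2 h, add_comm]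

theorem lin_mono {E : Type*} [Fintype E] {c : E → ℝ} (hc : ∀ e, 0 ≤ c e) : Monotone (lin c) :=
  fun _ _ h => Finset.sum_le_sum fun e _ => mul_le_mul_of_nonneg_left (spin_mono (h e)) (hc e)

theorem deg_mono (i : Fin n) : Monotone fun Y : Config n => deg Y i := by
  simp only [deg_eq_lin]
  exact lin_mono (inc_nonneg i)

theorem deg_inf_add_sup (X Y : Config n) (i : Fin n) :
    deg (X ⊓ Y) i + deg (X ⊔ Y) i = deg X i + deg Y i := by
  simp only [deg_eq_lin, lin, ← Finset.sum_add_distrib, ← mul_add]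
  exact Finset.sum_congr rfl fun e _ => congrArg _ (spin_inf_add_sup (X e) (Y e))

/-- The degrees at meet and join have the same sum as at `X` and `Y` but lie further apart, so their
squares have a larger sum. This is the lattice condition of the FKG inequality. -/
theorem energy_supermodular {θ : ℝ} (hθ : 0 ≤ θ) (hn : 1 ≤ n) (β : Fin n → ℝ)
    (X Y : Config n) :
    energy θ β X + energy θ β Y ≤ energy θ β (X ⊓ Y) + energy θ β (X ⊔ Y) := by
  have h1 : ∑ i, β i * deg X i + ∑ i, β i * deg Y i =
      ∑ i, β i * deg (X ⊓ Y) i + ∑ i, β i * deg (X ⊔ Y) i := by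
    simp only [← Finset.sum_add_distrib, ← mul_add, deg_inf_add_sup]
  have h2 : ∑ i, deg X i ^ 2 + ∑ i, deg Y i ^ 2 ≤
      ∑ i, deg (X ⊓ Y) i ^ 2 + ∑ i, deg (X ⊔ Y) i ^ 2 := by
    simp only [← Finset.sum_add_distrib]
    refine Finset.sum_le_sum fun i _ => ?_
    have a1 := deg_inf_add_sup X Y i
    have a2 : deg X i ≤ deg (X ⊔ Y) i := deg_mono i le_sup_left
    have a3 : deg Y i ≤ deg (X ⊔ Y) i := deg_mono i le_sup_right
    have a4 : deg (X ⊓ Y) i = deg X i + deg Y i - deg (X ⊔ Y) i := by linarith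
    rw [a4]
    nlinarith [mul_nonneg (sub_nonneg.2 a2) (sub_nonneg.2 a3)]
  have h3 := mul_le_mul_of_nonneg_left h2 (coupling_nonneg hθ hn)
  unfold energy
  linarith

theorem gcov_add_const_left {Ω : Type*} [Fintype Ω] [Nonempty Ω] (H X Y : Ω → ℝ) (c : ℝ) :
    gcov H (fun ω => X ω + c) Y = gcov H X Y := by
  rw [gcov_add_left, gcov_const_left, add_zero]

/-- Increasing functions are positively correlated. -/
theorem gcov_nonneg_of_monotone {θ : ℝ} (hθ : 0 ≤ θ) (hn : 1 ≤ n) (β : Fin n → ℝ)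
    {F G : Config n → ℝ} (hF : Monotone F) (hG : Monotone G) :
    0 ≤ gcov (energy θ β) F G := by
  have key : ∀ {F G : Config n → ℝ}, 0 ≤ F → 0 ≤ G → Monotone F → Monotone G →
      0 ≤ gcov (energy θ β) F G := by
    intro F G hF0 hG0 hF hG
    have h := fkg (μ := fun Y => Real.exp (energy θ β Y)) (f := F) (g := G)
      (fun Y => (Real.exp_pos _).le) hF0 hG0 hF hG fun X Y => by
        simp only [← Real.exp_add]
        exact Real.exp_le_exp.2 (energy_supermodular hθ hn β X Y)
    have hZ := sum_exp_pos (energy θ β)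
    simp only [mul_comm (Real.exp _)] at h
    unfold gcov gmean
    rw [sub_nonneg, div_mul_div_comm, div_le_div_iff₀ (by positivity) hZ]
    nlinarith
  -- Subtracting lower bounds makes both functions nonnegative, as `fkg` requires, and leaves the
  -- covariance unchanged.
  obtain ⟨a, ha⟩ := (Set.finite_range F).bddBelow
  obtain ⟨b, hb⟩ := (Set.finite_range G).bddBelow
  have h := key (F := fun Y => F Y + -a) (G := fun Y => G Y + -b)
    (fun Y => by have := ha ⟨Y, rfl⟩; simpa using this)
    (fun Y => by have := hb ⟨Y, rfl⟩; simpa using this)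
    (fun X Y h => by have := hF h; simpa using this)
    (fun X Y h => by have := hG h; simpa using this)
  rwa [gcov_add_const_left, gcov_comm, gcov_add_const_left, gcov_comm] at h

/-! ### The variance of the total degree -/

/-- The sum of all the signs. -/
def total (Y : Config n) : ℝ := ∑ e, spin (Y e)

theorem sum_deg_eq (Y : Config n) : ∑ i, deg Y i = 2 * total Y := by
  simp only [deg_eq_lin, lin, total]
  rw [Finset.sum_comm]
  simp only [← Finset.sum_mul, sum_inc_vertex, Finset.mul_sum]

theorem card_edge_eq : (Fintype.card (Edge n) : ℝ) = n * ((n : ℝ) - 1) / 2 := by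
  have h : ∑ e : Edge n, ∑ i, inc i e = ∑ i : Fin n, ∑ e, inc i e := Finset.sum_comm
  simp only [sum_inc_vertex, sum_inc_edge, Finset.sum_const, Finset.card_univ, nsmul_eq_mul,
    Fintype.card_fin] at h
  linarith

theorem sum_localField (θ : ℝ) (β : Fin n → ℝ) (Y : Config n) (hn : 2 ≤ n) :
    ∑ e, localField θ β e Y =
      2 * θ * (((n : ℝ) - 2) / ((n : ℝ) - 1)) * total Y + ∑ e, ∑ i, inc i e * (β i / 2) := by
  have hn1 : (n : ℝ) - 1 ≠ 0 := by
    have : (2 : ℝ) ≤ n := by exact_mod_cast hn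
    linarith
  have h1 : ∑ e, ∑ i, inc i e * deg Y i = ((n : ℝ) - 1) * (2 * total Y) := by
    rw [Finset.sum_comm, ← sum_deg_eq, Finset.mul_sum]
    exact Finset.sum_congr rfl fun i _ => by rw [← Finset.sum_mul, sum_inc_edge]
  have h2 : ∑ e, ∑ i, inc i e * spin (Y e) = 2 * total Y := by
    rw [total, Finset.mul_sum]
    exact Finset.sum_congr rfl fun e _ => by rw [← Finset.sum_mul, sum_inc_vertex]
  have h3 : ∀ e i, inc i e * (θ / ((n : ℝ) - 1) * (deg Y i - spin (Y e)) + β i / 2) =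
      θ / ((n : ℝ) - 1) * (inc i e * deg Y i - inc i e * spin (Y e)) + inc i e * (β i / 2) := by
    intro e i; ring
  unfold localField
  simp only [h3, Finset.sum_add_distrib, ← Finset.mul_sum, Finset.sum_sub_distrib, h1, h2]
  field_simp
  ring

theorem localField_mono {θ : ℝ} (hθ : 0 ≤ θ) (hn : 1 ≤ n) (β : Fin n → ℝ) (e : Edge n) :
    Monotone (localField θ β e) := by
  have hn1 : (0 : ℝ) ≤ (n : ℝ) - 1 := by
    have : (1 : ℝ) ≤ n := by exact_mod_cast hn
    linarith
  intro X Y h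
  refine Finset.sum_le_sum fun i _ => ?_
  have h1 : ∀ Z : Config n, inc i e * (deg Z i - spin (Z e)) =
      inc i e * ∑ f ∈ Finset.univ.erase e, inc i f * spin (Z f) := by
    intro Z
    have := Finset.add_sum_erase Finset.univ (fun f => inc i f * spin (Z f)) (Finset.mem_univ e)
    rw [deg_eq_lin, lin, ← this]
    linear_combination spin (Z e) * inc_mul_self i e
  have h2 : inc i e * (deg X i - spin (X e)) ≤ inc i e * (deg Y i - spin (Y e)) := by
    rw [h1, h1]
    refine mul_le_mul_of_nonneg_left (Finset.sum_le_sum fun f _ => ?_) (inc_nonneg i e)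
    exact mul_le_mul_of_nonneg_left (spin_mono (h f)) (inc_nonneg i f)
  have h3 := mul_le_mul_of_nonneg_left h2 (div_nonneg hθ hn1)
  nlinarith

theorem gmean_resid_mul_eq_zero (θ : ℝ) (β : Fin n → ℝ) (e : Edge n) {G : Config n → ℝ}
    (hG : ∀ Y, G (flip e Y) = G Y) : gmean (energy θ β) (fun Y => resid θ β e Y * G Y) = 0 := by
  rw [gmean_resid_mul]
  simp only [hG, sub_self, zero_div, mul_zero]
  exact gmean_const _ 0

theorem gcov_resid_eq_zero (θ : ℝ) (β : Fin n → ℝ) (e : Edge n) {G : Config n → ℝ}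
    (hG : ∀ Y, G (flip e Y) = G Y) : gcov (energy θ β) (resid θ β e) G = 0 := by
  have h := gmean_resid_mul_eq_zero θ β e (G := fun _ => 1) fun _ => rfl
  simp only [mul_one] at h
  unfold gcov
  rw [gmean_resid_mul_eq_zero θ β e hG, h, zero_mul, sub_zero]

/-- Split off `spin (Y e)` from `total`, with rest `R`. Conditional centering replaces the spin by
the tanh of its local field in the covariance with `R`, and positive association, applied to `x -
tanh x`, replaces the tanh by the field. The left-out covariance of the field with the spin is
nonnegative. -/
theorem gcov_spin_total_le {θ : ℝ} (hθ : 0 ≤ θ) (hn : 1 ≤ n) (β : Fin n → ℝ) (e : Edge n) :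
    gcov (energy θ β) (fun Y => spin (Y e)) total ≤
      1 + gcov (energy θ β) (localField θ β e) total := by
  set H := energy (n := n) θ β with hH
  set R : Config n → ℝ := fun Y => ∑ f ∈ Finset.univ.erase e, spin (Y f) with hR
  have hspin : Monotone fun Y : Config n => spin (Y e) := fun _ _ h => spin_mono (h e)
  have hRmono : Monotone R := fun _ _ h => Finset.sum_le_sum fun f _ => spin_mono (h f)
  have htot : (total : Config n → ℝ) = fun Y => spin (Y e) + R Y := by
    funext Y
    exact (Finset.add_sum_erase Finset.univ (fun f => spin (Y f)) (Finset.mem_univ e)).symm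
  have hRflip : ∀ Y, R (flip e Y) = R Y := fun Y =>
    Finset.sum_congr rfl fun f hf => by rw [flip_apply_of_ne (Finset.ne_of_mem_erase hf)]
  have h1 : ∀ X : Config n → ℝ, gcov H X total =
      gcov H X (fun Y => spin (Y e)) + gcov H X R := by
    intro X
    rw [htot, gcov_comm, gcov_add_left, gcov_comm, gcov_comm H R]
  have h2 : gcov H (fun Y => spin (Y e)) (fun Y => spin (Y e)) ≤ 1 := by
    unfold gcov
    simp only [spin_mul_self]
    rw [gmean_const]
    nlinarith [mul_self_nonneg (gmean H fun Y => spin (Y e))]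
  have h3 : gcov H (fun Y => spin (Y e)) R =
      gcov H (fun Y => Real.tanh (localField θ β e Y)) R := by
    have := gcov_resid_eq_zero θ β e hRflip
    unfold resid at this
    rw [gcov_sub_left] at this
    linarith
  have h4 : 0 ≤ gcov H (fun Y => localField θ β e Y - Real.tanh (localField θ β e Y)) R :=
    gcov_nonneg_of_monotone hθ hn β
      (monotone_tanh_and_monotone_id_sub_tanh.2.comp (localField_mono hθ hn β e)) hRmono
  rw [gcov_sub_left] at h4
  have h5 : 0 ≤ gcov H (localField θ β e) (fun Y => spin (Y e)) :=
    gcov_nonneg_of_monotone hθ hn β (localField_mono hθ hn β e) hspin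
  rw [h1, h1]
  have h6 : gcov H (fun Y => localField θ β e Y) R = gcov H (localField θ β e) R := rfl
  linarith

/-- At high temperature the variance of the number of edges is of the order of its mean. -/
theorem gcov_total_le {θ : ℝ} (hθ : 0 ≤ θ) (hθ' : θ < 1 / 2) (hn : 2 ≤ n) (β : Fin n → ℝ) :
    gcov (energy θ β) total total ≤ n * ((n : ℝ) - 1) / (2 * (1 - 2 * θ)) := by
  have hn2 : (2 : ℝ) ≤ n := by exact_mod_cast hn
  have hmono : Monotone (total : Config n → ℝ) :=
    fun _ _ h => Finset.sum_le_sum fun f _ => spin_mono (h f)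
  have hV := gcov_nonneg_of_monotone hθ (by omega) β hmono hmono
  -- Summed over the edges, the bound reads `V ≤ n (n - 1) / 2 + 2 θ V`, because the local fields
  -- add up to a multiple of `total`. It can be solved for `V` as `2 θ < 1`.
  have h1 : gcov (energy θ β) total total ≤
      ∑ e, (1 + gcov (energy θ β) (localField θ β e) total) := by
    refine le_trans (le_of_eq ?_)
      (Finset.sum_le_sum fun e _ => gcov_spin_total_le hθ (by omega) β e)
    exact gcov_sum_left Finset.univ _ (fun e (Y : Config n) => spin (Y e)) _
  rw [Finset.sum_add_distrib, ← gcov_sum_left, Finset.sum_const, Finset.card_univ, nsmul_eq_mul,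
    mul_one, card_edge_eq] at h1
  simp only [sum_localField θ β _ hn] at h1
  rw [gcov_add_const_left, gcov_const_mul_left] at h1
  have h2 : ((n : ℝ) - 2) / ((n : ℝ) - 1) ≤ 1 := by
    rw [div_le_one (by linarith)]; linarith
  have h3 : 2 * θ * (((n : ℝ) - 2) / ((n : ℝ) - 1)) * gcov (energy θ β) total total ≤
      2 * θ * 1 * gcov (energy θ β) total total := by gcongr
  rw [le_div_iff₀ (by linarith)]
  linarith

theorem wdeg_one (Y : Config n) : wdeg (fun _ => 1) Y = 2 * total Y := by
  simp only [wdeg, one_mul, sum_deg_eq]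

theorem abs_total_le (Y : Config n) : |total Y| ≤ n * ((n : ℝ) - 1) / 2 := by
  rw [← card_edge_eq, total]
  refine (Finset.abs_sum_le_sum_abs _ _).trans (le_of_eq ?_)
  simp [abs_spin]

/-- In a positive field the variance of the number of edges is of the order of its mean. -/
theorem gcov_total_le_of_pos {θ r : ℝ} (hθ : 0 ≤ θ) (hn : 1 ≤ n) (hr : 0 < r) :
    gcov (energy (n := n) θ fun _ => r) (wdeg fun _ => 1) (wdeg fun _ => 1) ≤
      4 / r * (n * ((n : ℝ) - 1)) := by
  set V := gcov (energy (n := n) θ fun _ => r) (wdeg fun _ => 1) (wdeg fun _ => 1) with hV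
  have e1 : ∀ t : ℝ, (fun Y : Config n => energy θ (fun _ => 0) Y +
      t * (r / 2 * wdeg (fun _ => 1) Y)) = energy θ fun _ => t * r := by
    intro t
    funext Y
    have := energy_add θ (fun _ : Fin n => 0) (fun _ => 1) (t * r) Y
    simp only [zero_add, mul_one] at this
    rw [this]; ring
  -- On the way from field `0` to `r` the mean grows at rate at least `r / 2 * V`, since by GHS the
  -- variance is smallest at the end. Its total growth is at most `2 n (n - 1)`.
  have h := sub_le_of_hasDerivAt_le (C := -(r / 2 * V))
    (fun t => (hasDerivAt_gmean (energy θ fun _ : Fin n => 0)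
      (fun Y => r / 2 * wdeg (fun _ => 1) Y) (wdeg fun _ => 1) t).neg) fun t ht => by
      rw [e1, gcov_const_mul_right]
      have h1 : V ≤ gcov (energy (n := n) θ fun _ => t * r) (wdeg fun _ => 1) (wdeg fun _ => 1) :=
        gcov_wdeg_anti hθ hn (fun _ => mul_nonneg ht.1 hr.le)
          (fun _ => mul_le_of_le_one_left hr.le ht.2) (fun _ => zero_le_one)
          fun _ => zero_le_one
      have := mul_le_mul_of_nonneg_left h1 (by linarith : 0 ≤ r / 2)
      linarith
  have hb : ∀ H : Config n → ℝ, |gmean H (wdeg fun _ => 1)| ≤ n * ((n : ℝ) - 1) := by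
    intro H
    refine (abs_gmean_le _ _).trans
      ((gmean_mono fun Y => ?_).trans_eq (gmean_const H (n * ((n : ℝ) - 1))))
    rw [wdeg_one, abs_mul, abs_two]
    linarith [abs_total_le Y]
  simp only [e1, Pi.neg_apply] at h
  have h1 := abs_le.1 (hb (energy θ fun _ => 1 * r))
  have h2 := abs_le.1 (hb (energy θ fun _ => 0 * r))
  have h3 : r / 2 * V ≤ 2 * (n * ((n : ℝ) - 1)) := by linarith
  rw [div_mul_eq_mul_div, le_div_iff₀ hr]
  linarith

/-! ### Exchangeability -/

/-- The action of a vertex permutation on edges. -/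
def edgeMap (σ : Equiv.Perm (Fin n)) (e : Edge n) : Edge n :=
  if h : σ e.1.1 < σ e.1.2 then ⟨(σ e.1.1, σ e.1.2), h⟩
  else ⟨(σ e.1.2, σ e.1.1), lt_of_le_of_ne (not_lt.1 h) fun h' =>
    absurd (σ.injective h') (ne_of_gt e.2)⟩

theorem edgeMap_inv (σ : Equiv.Perm (Fin n)) (e : Edge n) : edgeMap σ⁻¹ (edgeMap σ e) = e := by
  obtain ⟨⟨a, b⟩, hab⟩ := e
  have hab : a < b := hab
  by_cases h : σ a < σ b
  · simp [edgeMap, h, hab]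
  · simp [edgeMap, h, not_lt_of_ge hab.le]

/-- The action of a vertex permutation on edges, as a permutation. -/
def edgePerm (σ : Equiv.Perm (Fin n)) : Equiv.Perm (Edge n) :=
  ⟨edgeMap σ, edgeMap σ⁻¹, edgeMap_inv σ, fun e => by simpa using edgeMap_inv σ⁻¹ e⟩

theorem inc_edgePerm (σ : Equiv.Perm (Fin n)) (i : Fin n) (e : Edge n) :
    inc (σ i) (edgePerm σ e) = inc i e := by
  change inc (σ i) (edgeMap σ e) = inc i e
  unfold inc edgeMap
  split_ifs <;> simp_all [or_comm]

theorem deg_comp_edgePerm (σ : Equiv.Perm (Fin n)) (Y : Config n) (i : Fin n) :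
    deg (Y ∘ edgePerm σ) i = deg Y (σ i) := by
  simp only [deg_eq_lin, lin]
  rw [← Equiv.sum_comp (edgePerm σ) fun e => inc (σ i) e * spin (Y e)]
  exact Finset.sum_congr rfl fun e _ => by rw [inc_edgePerm]; rfl

theorem gcov_deg_perm (θ r : ℝ) (σ : Equiv.Perm (Fin n)) (i j : Fin n) :
    gcov (energy θ fun _ => r) (fun Y => deg Y (σ i)) (fun Y => deg Y (σ j)) =
      gcov (energy θ fun _ => r) (fun Y => deg Y i) (fun Y => deg Y j) := by
  have h := gcov_comp_equiv (Equiv.arrowCongr (edgePerm σ).symm (Equiv.refl ℤˣ))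
    (energy θ fun _ => r) (fun Y => deg Y i) (fun Y => deg Y j)
  have e : ∀ Y : Config n, Equiv.arrowCongr (edgePerm σ).symm (Equiv.refl ℤˣ) Y =
      Y ∘ edgePerm σ := fun Y => rfl
  simp only [e, deg_comp_edgePerm] at h
  have e2 : (fun Y : Config n => energy θ (fun _ => r) (Y ∘ edgePerm σ)) =
      energy θ fun _ => r := by
    funext Y
    simp only [energy, deg_comp_edgePerm]
    rw [Equiv.sum_comp σ fun i => deg Y i ^ 2, Equiv.sum_comp σ fun i => r * deg Y i]
  rwa [e2] at h

theorem exists_perm_of_ne {i j a b : Fin n} (hij : i ≠ j) (hab : a ≠ b) :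
    ∃ σ : Equiv.Perm (Fin n), σ i = a ∧ σ j = b := by
  refine ⟨Equiv.swap (Equiv.swap i a j) b * Equiv.swap i a, ?_, ?_⟩
  · rw [Equiv.Perm.mul_apply, Equiv.swap_apply_left, Equiv.swap_apply_of_ne_of_ne _ hab]
    intro h
    have : Equiv.swap i a i = Equiv.swap i a j := by rwa [Equiv.swap_apply_left]
    exact hij ((Equiv.swap i a).injective this)
  · rw [Equiv.Perm.mul_apply, Equiv.swap_apply_left]

theorem gcov_wdeg_eq_sum (H : Config n → ℝ) (u v : Fin n → ℝ) :
    gcov H (wdeg u) (wdeg v) =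
      ∑ i, ∑ j, u i * v j * gcov H (fun Y => deg Y i) (fun Y => deg Y j) := by
  have h1 := gcov_sum_left Finset.univ H (fun i Y => u i * deg Y i) (wdeg v)
  refine h1.trans (Finset.sum_congr rfl fun i _ => ?_)
  have h2 := gcov_sum_right Finset.univ H (fun Y => u i * deg Y i) (fun j Y => v j * deg Y j)
  refine h2.trans (Finset.sum_congr rfl fun j _ => ?_)
  rw [gcov_const_mul_left, gcov_const_mul_right]
  ring

/-- By exchangeability there is one variance and one covariance, both nonnegative by association.
The `n` diagonal and the `n (n - 1)` off-diagonal terms are each bounded by the variance of the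
whole sum. -/
theorem gcov_deg_le {θ r K : ℝ} (hθ : 0 ≤ θ) (hn : 2 ≤ n)
    (hK : gcov (energy (n := n) θ fun _ => r) (wdeg fun _ => 1) (wdeg fun _ => 1) ≤
      K * (n * ((n : ℝ) - 1))) (i j : Fin n) :
    gcov (energy θ fun _ => r) (fun Y => deg Y i) (fun Y => deg Y j) ≤
      if i = j then K * ((n : ℝ) - 1) else K := by
  have hn2 : (2 : ℝ) ≤ n := by exact_mod_cast hn
  have hn1 : (0 : ℝ) < (n : ℝ) - 1 := by linarith
  set V : Fin n → Fin n → ℝ := fun i j =>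
    gcov (energy θ fun _ => r) (fun Y => deg Y i) (fun Y => deg Y j) with hVdef
  have hV : ∀ i j, 0 ≤ V i j := fun i j =>
    gcov_nonneg_of_monotone hθ (by omega) _ (deg_mono i) (deg_mono j)
  rw [gcov_wdeg_eq_sum] at hK
  simp only [one_mul] at hK
  change V i j ≤ _
  split_ifs with hij
  · subst hij
    have h1 : ∀ a, V i i ≤ ∑ b, V a b := by
      intro a
      have : V i i = V a a := by
        have := gcov_deg_perm θ r (Equiv.swap i a) i i
        rw [Equiv.swap_apply_left] at this
        exact this.symm
      rw [this]
      exact Finset.single_le_sum (fun b _ => hV a b) (Finset.mem_univ a)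
    have h2 := Finset.card_nsmul_le_sum Finset.univ (fun a => ∑ b, V a b) (V i i)
      fun a _ => h1 a
    rw [Finset.card_univ, Fintype.card_fin, nsmul_eq_mul] at h2
    have h3 : (n : ℝ) * V i i ≤ n * (K * ((n : ℝ) - 1)) := by linarith
    exact le_of_mul_le_mul_left h3 (by linarith)
  · have h1 : ∀ a, ((n : ℝ) - 1) * V i j ≤ ∑ b, V a b := by
      intro a
      refine le_trans ?_ (Finset.sum_le_sum_of_subset_of_nonneg
        (Finset.subset_univ (Finset.univ.erase a)) fun b _ _ => hV a b)
      have h2 := Finset.card_nsmul_le_sum (Finset.univ.erase a) (fun b => V a b) (V i j)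
        fun b hb => by
          obtain ⟨σ, h1, h2⟩ := exists_perm_of_ne hij (Finset.ne_of_mem_erase hb).symm
          have := gcov_deg_perm θ r σ i j
          rw [h1, h2] at this
          exact this.ge
      rw [Finset.card_erase_of_mem (Finset.mem_univ a), Finset.card_univ, Fintype.card_fin,
        nsmul_eq_mul, Nat.cast_sub (by omega), Nat.cast_one] at h2
      exact h2
    have h2 := Finset.card_nsmul_le_sum Finset.univ (fun a => ∑ b, V a b) _ fun a _ => h1 a
    rw [Finset.card_univ, Fintype.card_fin, nsmul_eq_mul] at h2
    have h3 : ((n : ℝ) * ((n : ℝ) - 1)) * V i j ≤ (n * ((n : ℝ) - 1)) * K := by linarith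
    exact le_of_mul_le_mul_left h3 (by positivity)

theorem gcov_wdeg_le {θ r K : ℝ} (hθ : 0 ≤ θ) (hK0 : 0 ≤ K) (hn : 2 ≤ n)
    (hK : gcov (energy (n := n) θ fun _ => r) (wdeg fun _ => 1) (wdeg fun _ => 1) ≤
      K * (n * ((n : ℝ) - 1))) {u v : Fin n → ℝ} (hu : ∀ i, 0 ≤ u i) (hv : ∀ i, 0 ≤ v i) :
    gcov (energy θ fun _ => r) (wdeg u) (wdeg v) ≤
      K * (n * ∑ i, u i * v i + (∑ i, u i) * ∑ i, v i) := by
  rw [gcov_wdeg_eq_sum]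
  have h1 : ∀ i j, u i * v j * gcov (energy θ fun _ => r) (fun Y => deg Y i) (fun Y => deg Y j) ≤
      (if i = j then u i * v j * (K * n) else 0) + u i * v j * K := by
    intro i j
    have huv := mul_nonneg (hu i) (hv j)
    have h2 := mul_le_mul_of_nonneg_left (gcov_deg_le hθ hn hK i j) huv
    refine h2.trans ?_
    split_ifs
    · have : 0 ≤ u i * v j * K := mul_nonneg huv hK0
      linarith
    · linarith
  refine (Finset.sum_le_sum fun i _ => Finset.sum_le_sum fun j _ => h1 i j).trans (le_of_eq ?_)
  simp only [Finset.sum_add_distrib, Finset.sum_ite_eq, Finset.mem_univ, if_true,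
    ← Finset.sum_mul, Finset.sum_mul_sum]
  ring

end Covariance

/-! ### Lower bounds -/

section LowerBound

variable {n : ℕ}

/-- Uniform covariance bound near the null hypothesis. -/
theorem exists_gcov_wdeg_le {θ β₀ : ℝ} (hΘ : (θ, β₀) ∈ Theta1) :
    ∃ K : ℝ, 0 ≤ K ∧ ∃ δ : ℝ, 0 < δ ∧ ∀ n : ℕ, 2 ≤ n → ∀ β : Fin n → ℝ,
      (∀ i, β₀ ≤ β i) → (∀ i, β i ≤ β₀ + δ) → ∀ u v : Fin n → ℝ, (∀ i, 0 ≤ u i) →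
      (∀ i, 0 ≤ v i) → gcov (energy θ β) (wdeg u) (wdeg v) ≤
        K * (n * ∑ i, u i * v i + (∑ i, u i) * ∑ i, v i) := by
  rcases hΘ with ⟨⟨h1, h2⟩, h3⟩ | ⟨h1, h2⟩
  · have h1 : 0 < θ := h1
    have h2 : θ < 1 / 2 := h2
    have h3 : β₀ = 0 := h3
    subst h3
    have hpos : 0 < 1 - 2 * θ := by linarith
    -- The width `δ = 1` is arbitrary: every nonnegative field is compared with the zero field.
    refine ⟨2 / (1 - 2 * θ), by positivity, 1, one_pos, fun n hn β hβ _ u v hu hv => ?_⟩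
    refine (gcov_wdeg_anti h1.le (by omega) (ρ := fun _ => 0) (fun _ => le_rfl) hβ hu hv).trans
      (gcov_wdeg_le h1.le (by positivity) hn ?_ hu hv)
    have e : (wdeg fun _ : Fin n => 1) = fun Y => 2 * total Y := funext wdeg_one
    rw [e, gcov_const_mul_left, gcov_const_mul_right]
    have := gcov_total_le h1.le h2 hn fun _ => (0 : ℝ)
    refine le_trans (by linarith : _ ≤ 4 * (n * ((n : ℝ) - 1) / (2 * (1 - 2 * θ))))
      (le_of_eq ?_)
    field_simp
    ring
  · have h1 : 0 < θ := h1
    have h2 : β₀ ≠ 0 := h2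
    rcases lt_or_gt_of_ne h2 with hneg | hpos
    -- After a global sign reversal the fields must stay bounded away from zero. The choice `δ = -β₀
    -- / 2` keeps them at least `-β₀ / 2`.
    · refine ⟨4 / (-β₀ / 2), div_nonneg (by norm_num) (by linarith), -β₀ / 2, by linarith,
        fun n hn β _ hβ u v hu hv => ?_⟩
      rw [← gcov_wdeg_neg]
      refine (gcov_wdeg_anti h1.le (by omega) (ρ := fun _ => -β₀ / 2) (fun _ => by linarith)
        (fun i => by linarith [hβ i]) hu hv).trans
        (gcov_wdeg_le h1.le (div_nonneg (by norm_num) (by linarith)) hn ?_ hu hv)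
      exact gcov_total_le_of_pos h1.le (by omega) (by linarith)
    · refine ⟨4 / β₀, by positivity, 1, one_pos, fun n hn β hβ _ u v hu hv => ?_⟩
      refine (gcov_wdeg_anti h1.le (by omega) (ρ := fun _ => β₀) (fun _ => hpos.le)
        hβ hu hv).trans (gcov_wdeg_le h1.le (by positivity) hn ?_ hu hv)
      exact gcov_total_le_of_pos h1.le (by omega) hpos

/-- The logarithm of the partition function. -/
def logZ (θ : ℝ) (β : Fin n → ℝ) : ℝ := Real.log (∑ Y, Real.exp (energy θ β Y))

theorem hasDerivAt_logZ (θ : ℝ) (β μ : Fin n → ℝ) (t : ℝ) :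
    HasDerivAt (fun t : ℝ => logZ θ fun i => β i + t * μ i)
      (1 / 2 * gmean (energy θ fun i => β i + t * μ i) (wdeg μ)) t := by
  have h := hasDerivAt_log_sum_exp (energy θ β) (fun Y => 1 / 2 * wdeg μ Y) t
  rw [gmean_const_mul] at h
  simp only [← energy_add] at h
  exact h

theorem hasDerivAt_gmean_energy (θ : ℝ) (β μ : Fin n → ℝ) (X : Config n → ℝ) (t : ℝ) :
    HasDerivAt (fun t : ℝ => gmean (energy θ fun i => β i + t * μ i) X)
      (1 / 2 * gcov (energy θ fun i => β i + t * μ i) X (wdeg μ)) t := by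
  have h := hasDerivAt_gmean (energy θ β) (fun Y => 1 / 2 * wdeg μ Y) X t
  rw [gcov_const_mul_right] at h
  simp only [← energy_add] at h
  exact h

/-- A bound for the mixed second difference of the log partition function. -/
theorem logZ_mixed_le {θ B : ℝ} {β μ ν : Fin n → ℝ}
    (hB : ∀ u ∈ Set.Icc (0 : ℝ) 1, ∀ v ∈ Set.Icc (0 : ℝ) 1,
      gcov (energy θ fun i => β i + u * ν i + v * μ i) (wdeg ν) (wdeg μ) ≤ B) :
    logZ θ (fun i => β i + μ i + ν i) - logZ θ (fun i => β i + μ i) -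
      logZ θ (fun i => β i + ν i) + logZ θ β ≤ B / 4 := by
  -- Two successive mean value bounds, in `u` and then in `v`, each carrying the factor `1 / 2` of
  -- the field term.
  have h := sub_le_of_hasDerivAt_le (C := B / 4) (fun u =>
    (hasDerivAt_logZ θ (fun i => β i + μ i) ν u).sub (hasDerivAt_logZ θ β ν u)) fun u hu => by
      have h1 := sub_le_of_hasDerivAt_le (C := B / 2)
        (hasDerivAt_gmean_energy θ (fun i => β i + u * ν i) μ (wdeg ν)) fun v hv => by
          linarith [hB u hu v hv]
      simp only [one_mul, zero_mul, add_zero] at h1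
      have e : (fun i => β i + μ i + u * ν i) = fun i => β i + u * ν i + μ i := by
        funext i; ring
      rw [e]
      linarith
  simp only [Pi.sub_apply, one_mul, zero_mul, add_zero] at h
  linarith

/-! ### Second moments of likelihood ratios. -/

theorem pmf_eq_exp (θ : ℝ) (β : Fin n → ℝ) (Y : Config n) :
    pmf θ β Y = Real.exp (energy θ β Y - logZ θ β) := by
  rw [pmf_eq, Real.exp_sub, logZ, Real.exp_log (sum_exp_pos _)]

theorem sum_pmf (θ : ℝ) (β : Fin n → ℝ) : ∑ Y, pmf θ β Y = 1 := by
  simp only [pmf_eq, ← Finset.sum_div]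
  exact div_self (sum_exp_pos _).ne'

/-- The field enters the energy linearly, so the product of two likelihood ratios is, up to
normalization, the weight with both signals added. -/
theorem sum_pmf_mul_div (θ : ℝ) (β μ ν : Fin n → ℝ) :
    ∑ Y, pmf θ (fun i => β i + μ i) Y * pmf θ (fun i => β i + ν i) Y / pmf θ β Y =
      Real.exp (logZ θ (fun i => β i + μ i + ν i) - logZ θ (fun i => β i + μ i) -
        logZ θ (fun i => β i + ν i) + logZ θ β) := by
  have e : ∀ Y : Config n, energy θ (fun i => β i + μ i) Y + energy θ (fun i => β i + ν i) Y -
      energy θ β Y = energy θ (fun i => β i + μ i + ν i) Y := by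
    intro Y
    have h1 := energy_add θ β μ 1 Y
    have h2 := energy_add θ β ν 1 Y
    have h3 := energy_add θ (fun i => β i + μ i) ν 1 Y
    simp only [one_mul] at h1 h2 h3
    linarith
  have h : ∀ Y : Config n, pmf θ (fun i => β i + μ i) Y * pmf θ (fun i => β i + ν i) Y /
      pmf θ β Y = Real.exp (energy θ (fun i => β i + μ i + ν i) Y) *
        Real.exp (-logZ θ (fun i => β i + μ i) - logZ θ (fun i => β i + ν i) + logZ θ β) := by
    intro Y
    rw [pmf_eq_exp, pmf_eq_exp, pmf_eq_exp, ← Real.exp_add, ← Real.exp_sub, ← Real.exp_add, ← e]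
    ring_nf
  simp only [h, ← Finset.sum_mul]
  have h2 : ∑ Y : Config n, Real.exp (energy θ (fun i => β i + μ i + ν i) Y) =
      Real.exp (logZ θ fun i => β i + μ i + ν i) := by
    rw [logZ, Real.exp_log (sum_exp_pos _)]
  rw [h2, ← Real.exp_add]
  ring_nf

open Classical in
/-- Le Cam's second moment bound: the difference of the probabilities of an event under a mixture
and under a reference distribution is controlled by the chi-square divergence. -/
theorem neg_sqrt_le_sum_sub {Ω ι : Type*} [Fintype Ω] [Fintype ι] [Nonempty ι]
    {p : Ω → ℝ} (q : ι → Ω → ℝ) (hp : ∀ ω, 0 < p ω) (hp1 : ∑ ω, p ω = 1)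
    (hq1 : ∀ f, ∑ ω, q f ω = 1) (S : Set Ω) {Q : ℝ}
    (hQ : ∑ f, ∑ f', ∑ ω, q f ω * q f' ω / p ω ≤ (Fintype.card ι : ℝ) ^ 2 * (1 + Q)) :
    (Fintype.card ι : ℝ) * (∑ ω, if ω ∈ S then p ω else 0) -
      ∑ f, ∑ ω, (if ω ∈ S then q f ω else 0) ≤ (Fintype.card ι : ℝ) * Real.sqrt Q := by
  set N : ℝ := (Fintype.card ι : ℝ) with hN
  have hN0 : 0 < N := by rw [hN]; exact_mod_cast Fintype.card_pos
  set q' : Ω → ℝ := fun ω => ∑ f, q f ω with hq'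
  have e1 : N * (∑ ω, if ω ∈ S then p ω else 0) - ∑ f, ∑ ω, (if ω ∈ S then q f ω else 0) =
      ∑ ω, if ω ∈ S then N * p ω - q' ω else 0 := by
    rw [Finset.sum_comm, Finset.mul_sum, ← Finset.sum_sub_distrib]
    refine Finset.sum_congr rfl fun ω _ => ?_
    by_cases h : ω ∈ S <;> simp [h, hq']
  have e2 : ∑ f, ∑ f', ∑ ω, q f ω * q f' ω / p ω = ∑ ω, q' ω ^ 2 / p ω := by
    have : ∀ ω, q' ω ^ 2 / p ω = ∑ f, ∑ f', q f ω * q f' ω / p ω := by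
      intro ω
      rw [sq, hq', Finset.sum_mul_sum]
      simp only [Finset.sum_div]
    simp only [this]
    rw [Finset.sum_comm]
    rw [Finset.sum_congr rfl fun f' _ => Finset.sum_comm]
    rw [Finset.sum_comm]
    rw [Finset.sum_congr rfl fun ω _ => Finset.sum_comm]
  have e3 : ∑ ω, (N * p ω - q' ω) ^ 2 / p ω = ∑ ω, q' ω ^ 2 / p ω - N ^ 2 := by
    have h1 : ∀ ω, (N * p ω - q' ω) ^ 2 / p ω = N ^ 2 * p ω - 2 * N * q' ω + q' ω ^ 2 / p ω := by
      intro ω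
      have := (hp ω).ne'
      field_simp
      ring
    have h2 : ∑ ω, q' ω = N := by
      rw [hq', Finset.sum_comm]
      simp [hq1, hN]
    simp only [h1, Finset.sum_add_distrib, Finset.sum_sub_distrib, ← Finset.mul_sum, hp1, h2]
    ring
  -- Cauchy–Schwarz against the weights `p`. The mixture is kept unnormalized, with total mass `N`.
  have hcs := Finset.sum_sq_le_sum_mul_sum_of_sq_le_mul Finset.univ
    (r := fun ω => if ω ∈ S then N * p ω - q' ω else 0) (f := p)
    (g := fun ω => if ω ∈ S then (N * p ω - q' ω) ^ 2 / p ω else 0)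
    (fun ω _ => (hp ω).le)
    (fun ω _ => by
      have := hp ω
      split_ifs
      · positivity
      · exact le_rfl)
    (fun ω _ => by
      have := (hp ω).ne'
      split_ifs
      · exact le_of_eq (by field_simp)
      · simp)
  rw [hp1, one_mul] at hcs
  have h4 : ∑ ω, (if ω ∈ S then (N * p ω - q' ω) ^ 2 / p ω else 0) ≤
      ∑ ω, (N * p ω - q' ω) ^ 2 / p ω := by
    refine Finset.sum_le_sum fun ω _ => ?_
    have := hp ω
    split_ifs
    · exact le_rfl
    · positivity
  rw [e1]
  have h5 : (∑ ω, if ω ∈ S then N * p ω - q' ω else 0) ^ 2 ≤ N ^ 2 * Q := by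
    rw [e3, ← e2] at h4
    linarith
  refine (Real.le_sqrt_of_sq_le h5).trans (le_of_eq ?_)
  rw [Real.sqrt_mul (by positivity), Real.sqrt_sq hN0.le]

/-- Lower bound for the risk in terms of the second moment of the likelihood ratio of a mixture. -/
theorem one_sub_sqrt_le_risk {ι : Type*} [Fintype ι] [Nonempty ι] {θ β₀ s A Q : ℝ}
    (μ : ι → Fin n → ℝ) (hμ : ∀ f, (fun i => β₀ + μ f i) ∈ alternatives n β₀ s A)
    (hQ : ∑ f, ∑ f', Real.exp (logZ θ (fun i => β₀ + μ f i + μ f' i) -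
      logZ θ (fun i => β₀ + μ f i) - logZ θ (fun i => β₀ + μ f' i) + logZ θ fun _ : Fin n => β₀) ≤
      (Fintype.card ι : ℝ) ^ 2 * (1 + Q)) (T : Test n) :
    1 - Real.sqrt Q ≤ risk θ β₀ s A T := by
  classical
  have hN0 : (0 : ℝ) < Fintype.card ι := by exact_mod_cast Fintype.card_pos
  have hbdd : BddAbove (Set.range fun β : alternatives n β₀ s A => prob θ β.1 {Y | T Y = 0}) :=
    ⟨1, by rintro _ ⟨β, rfl⟩; exact prob_le_one _ _ _⟩
  have h1 : ∀ f, prob θ (fun i => β₀ + μ f i) {Y | T Y = 0} ≤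
      ⨆ β : alternatives n β₀ s A, prob θ β.1 {Y | T Y = 0} := fun f =>
    le_ciSup hbdd ⟨_, hμ f⟩
  have h2 := Finset.sum_le_card_nsmul Finset.univ _ _ fun f _ => h1 f
  rw [nsmul_eq_mul, Finset.card_univ] at h2
  have h3 : (Fintype.card ι : ℝ) * prob θ (fun _ => β₀) {Y : Config n | T Y = 0} -
      ∑ f, prob θ (fun i => β₀ + μ f i) {Y | T Y = 0} ≤ (Fintype.card ι : ℝ) * Real.sqrt Q :=
    neg_sqrt_le_sum_sub (p := pmf θ fun _ => β₀) (fun f => pmf θ fun i => β₀ + μ f i)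
    (fun Y => by rw [pmf_eq_exp]; exact Real.exp_pos _) (sum_pmf _ _) (fun f => sum_pmf _ _)
    {Y | T Y = 0} (Q := Q) (by
      refine le_trans (le_of_eq ?_) hQ
      exact Finset.sum_congr rfl fun f _ => Finset.sum_congr rfl fun f' _ =>
        sum_pmf_mul_div θ (fun _ => β₀) (μ f) (μ f'))
  have h4 : prob θ (fun _ => β₀) {Y : Config n | T Y = 1} +
      prob θ (fun _ => β₀) {Y | T Y = 0} = 1 := by
    rw [← sum_pmf θ fun _ : Fin n => β₀]
    unfold prob
    rw [← Finset.sum_add_distrib]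
    refine Finset.sum_congr rfl fun Y _ => ?_
    have : T Y = 0 ∨ T Y = 1 := by
      generalize T Y = z
      fin_cases z <;> simp
    rcases this with h | h <;> simp [h]
  unfold risk
  have h6 : (Fintype.card ι : ℝ) * (prob θ (fun _ => β₀) {Y : Config n | T Y = 0} -
      ⨆ β : alternatives n β₀ s A, prob θ β.1 {Y | T Y = 0}) ≤
      (Fintype.card ι : ℝ) * Real.sqrt Q := by linarith
  have h7 := le_of_mul_le_mul_left h6 hN0
  linarith

/-! ### The block prior -/

/-- The signal that raises one vertex of each block, the one selected by `f`. -/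
def blockSignal {s m : ℕ} (φ : Fin s × Fin m ↪ Fin n) (A : ℝ) (f : Fin s → Fin m)
    (i : Fin n) : ℝ := ∑ a, if φ (a, f a) = i then A else 0

variable {s m : ℕ} (φ : Fin s × Fin m ↪ Fin n)

theorem blockSignal_nonneg {A : ℝ} (hA : 0 ≤ A) (f : Fin s → Fin m) (i : Fin n) :
    0 ≤ blockSignal φ A f i :=
  Finset.sum_nonneg fun a _ => by split_ifs <;> simp [hA]

theorem blockSignal_le {A : ℝ} (hA : 0 ≤ A) (f : Fin s → Fin m) (i : Fin n) :
    blockSignal φ A f i ≤ A := by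
  unfold blockSignal
  rw [← Finset.sum_filter, Finset.sum_const, nsmul_eq_mul]
  have : (Finset.univ.filter fun a => φ (a, f a) = i).card ≤ 1 := by
    refine Finset.card_le_one.2 fun a ha b hb => ?_
    simp only [Finset.mem_filter, Finset.mem_univ, true_and] at ha hb
    exact (Prod.ext_iff.1 (φ.injective (ha.trans hb.symm))).1
  exact mul_le_of_le_one_left hA (by exact_mod_cast this)

theorem le_blockSignal {A : ℝ} (hA : 0 ≤ A) (f : Fin s → Fin m) (a : Fin s) :
    A ≤ blockSignal φ A f (φ (a, f a)) := by
  have := Finset.single_le_sum (f := fun b => if φ (b, f b) = φ (a, f a) then A else 0)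
    (fun b _ => by split_ifs <;> simp [hA]) (Finset.mem_univ a)
  rwa [if_pos rfl] at this

theorem sum_blockSignal (A : ℝ) (f : Fin s → Fin m) :
    ∑ i, blockSignal φ A f i = s * A := by
  unfold blockSignal
  rw [Finset.sum_comm]
  simp

theorem sum_blockSignal_mul (A : ℝ) (f g : Fin s → Fin m) :
    ∑ i, blockSignal φ A f i * blockSignal φ A g i =
      A ^ 2 * ∑ a, if f a = g a then 1 else 0 := by
  unfold blockSignal
  simp only [Finset.sum_mul_sum]
  rw [Finset.sum_comm, Finset.mul_sum]
  refine Finset.sum_congr rfl fun a _ => ?_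
  rw [Finset.sum_comm]
  have h : ∀ b i, (if φ (a, f a) = i then A else 0) * (if φ (b, g b) = i then A else 0) =
      if φ (a, f a) = i then (if φ (b, g b) = φ (a, f a) then A ^ 2 else 0) else 0 := by
    intro b i
    by_cases h : φ (a, f a) = i
    · subst h; simp [sq]
    · simp [h]
  simp only [h, Finset.sum_ite_eq, Finset.mem_univ, if_true]
  rw [Finset.sum_eq_single a]
  · by_cases h : f a = g a
    · simp [h]
    · simp [h, Ne.symm h]
  · intro b _ hb
    rw [if_neg]
    intro h
    exact hb (Prod.ext_iff.1 (φ.injective h)).1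
  · simp

theorem blockSignal_mem_alternatives {A σ : ℝ} (β₀ : ℝ) (hA : 0 < A) (hσ : σ ≤ s)
    (f : Fin s → Fin m) : (fun i => β₀ + blockSignal φ A f i) ∈ alternatives n β₀ σ A := by
  have hsupp : Function.support (blockSignal φ A f) = Set.range fun a => φ (a, f a) := by
    ext i
    constructor
    · intro hi
      by_contra h
      refine hi (Finset.sum_eq_zero fun a _ => if_neg fun h' => h ⟨a, h'⟩)
    · rintro ⟨a, rfl⟩
      exact (hA.trans_le (le_blockSignal φ hA.le f a)).ne'
  refine ⟨blockSignal φ A f, fun i => rfl, ?_, ?_⟩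
  · have hinj : Function.Injective fun a => φ (a, f a) := fun a b h =>
      (Prod.ext_iff.1 (φ.injective h)).1
    rw [hsupp, ← Set.image_univ, Set.ncard_image_of_injective _ hinj, Set.ncard_univ,
      Nat.card_eq_fintype_card, Fintype.card_fin]
    exact hσ
  · intro i hi
    rw [hsupp] at hi
    obtain ⟨a, rfl⟩ := hi
    exact le_blockSignal φ hA.le f a

/-- For a fixed `f` and a uniform `g` the blocks agree independently with probability `1 / m`, so
the exponential moment is an exact product, bounded by `1 + y ≤ exp y`. This independence is the
reason for the block prior. -/
theorem sum_exp_agree (hm : 1 ≤ m) (x : ℝ) (hx : 0 ≤ x) (f : Fin s → Fin m) :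
    ∑ g : Fin s → Fin m, Real.exp (x * ∑ a, if f a = g a then 1 else 0) ≤
      (m : ℝ) ^ s * Real.exp (s * (Real.exp x - 1) / m) := by
  have hm0 : (0 : ℝ) < m := by exact_mod_cast hm
  have h1 : ∀ g : Fin s → Fin m, Real.exp (x * ∑ a, if f a = g a then 1 else 0) =
      ∏ a, if f a = g a then Real.exp x else 1 := by
    intro g
    rw [Finset.mul_sum, Real.exp_sum]
    refine Finset.prod_congr rfl fun a _ => ?_
    split_ifs <;> simp
  simp only [h1]
  rw [← Fintype.prod_sum fun (a : Fin s) (v : Fin m) => if f a = v then Real.exp x else 1]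
  have h2 : ∀ a : Fin s, ∑ v : Fin m, (if f a = v then Real.exp x else 1) =
      m * (1 + (Real.exp x - 1) / m) := by
    intro a
    have : ∀ v : Fin m, (if f a = v then Real.exp x else (1 : ℝ)) =
        1 + if f a = v then Real.exp x - 1 else 0 := by
      intro v; split_ifs <;> ring
    simp only [this, Finset.sum_add_distrib, Finset.sum_ite_eq, Finset.mem_univ, if_true]
    simp
    field_simp
  simp only [h2, Finset.prod_const, Finset.card_univ, Fintype.card_fin, mul_pow]
  gcongr
  have h3 : 0 ≤ (Real.exp x - 1) / m := div_nonneg (by linarith [Real.one_le_exp hx]) hm0.le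
  calc (1 + (Real.exp x - 1) / m) ^ s ≤ Real.exp ((Real.exp x - 1) / m) ^ s := by
        gcongr
        linarith [Real.add_one_le_exp ((Real.exp x - 1) / m)]
    _ = _ := by rw [← Real.exp_nat_mul]; ring_nf

/-- The covariance bound splits the mixed difference into a deterministic part of order `(s * A) ^
2` and `n * A ^ 2` times the overlap, which `sum_exp_agree` averages. Two superposed signals reach
height `2 * A`, hence `2 * A ≤ δ`. -/
theorem one_sub_sqrt_exp_le_risk (φ : Fin s × Fin m ↪ Fin n) {θ β₀ K δ A σ : ℝ} (hK0 : 0 ≤ K) (hA : 0 < A)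
    (hAδ : 2 * A ≤ δ) (hσ : σ ≤ s) (hm : 1 ≤ m)
    (hK : ∀ β : Fin n → ℝ, (∀ i, β₀ ≤ β i) → (∀ i, β i ≤ β₀ + δ) → ∀ u v : Fin n → ℝ,
      (∀ i, 0 ≤ u i) → (∀ i, 0 ≤ v i) → gcov (energy θ β) (wdeg u) (wdeg v) ≤
        K * (n * ∑ i, u i * v i + (∑ i, u i) * ∑ i, v i)) (T : Test n) :
    1 - Real.sqrt (Real.exp (K / 4 * (s * A) ^ 2 +
      s * (Real.exp (K / 4 * (n * A ^ 2)) - 1) / m) - 1) ≤ risk θ β₀ σ A T := by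
  have hne : Nonempty (Fin m) := ⟨⟨0, hm⟩⟩
  refine one_sub_sqrt_le_risk (blockSignal φ A)
    (blockSignal_mem_alternatives φ β₀ hA hσ) ?_ T
  have hD : ∀ f g : Fin s → Fin m,
      logZ θ (fun i => β₀ + blockSignal φ A f i + blockSignal φ A g i) -
      logZ θ (fun i => β₀ + blockSignal φ A f i) - logZ θ (fun i => β₀ + blockSignal φ A g i) +
      logZ θ (fun _ : Fin n => β₀) ≤
      K / 4 * (s * A) ^ 2 + K / 4 * (n * A ^ 2) * ∑ a, if f a = g a then 1 else 0 := by
    intro f g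
    have hf := blockSignal_nonneg φ hA.le f
    have hg := blockSignal_nonneg φ hA.le g
    have hf' := blockSignal_le φ hA.le f
    have hg' := blockSignal_le φ hA.le g
    refine (logZ_mixed_le (β := fun _ => β₀) (μ := blockSignal φ A f)
      (ν := blockSignal φ A g) fun u hu v hv =>
        hK _ (fun i => ?_) (fun i => ?_) _ _ hg hf).trans (le_of_eq ?_)
    · have := mul_nonneg hu.1 (hg i)
      have := mul_nonneg hv.1 (hf i)
      linarith
    · have := mul_le_of_le_one_left (hg i) hu.2
      have := mul_le_of_le_one_left (hf i) hv.2
      linarith [hf' i, hg' i]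
    · rw [sum_blockSignal_mul, sum_blockSignal, sum_blockSignal]
      simp only [eq_comm (a := g _)]
      ring
  have hx : 0 ≤ K / 4 * (n * A ^ 2) := by positivity
  have h1 : ∀ f : Fin s → Fin m, ∑ g : Fin s → Fin m,
      Real.exp (logZ θ (fun i => β₀ + blockSignal φ A f i + blockSignal φ A g i) -
      logZ θ (fun i => β₀ + blockSignal φ A f i) - logZ θ (fun i => β₀ + blockSignal φ A g i) +
      logZ θ (fun _ : Fin n => β₀)) ≤ (m : ℝ) ^ s * Real.exp (K / 4 * (s * A) ^ 2 +
      s * (Real.exp (K / 4 * (n * A ^ 2)) - 1) / m) := by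
    intro f
    refine (Finset.sum_le_sum fun g _ => Real.exp_le_exp.2 (hD f g)).trans ?_
    simp only [Real.exp_add (K / 4 * (s * A) ^ 2), ← Finset.mul_sum]
    have := mul_le_mul_of_nonneg_left (sum_exp_agree hm _ hx f)
      (Real.exp_pos (K / 4 * (s * A) ^ 2)).le
    simp only [Finset.mul_sum] at this ⊢
    linarith
  refine (Finset.sum_le_card_nsmul _ _ _ fun f _ => h1 f).trans (le_of_eq ?_)
  rw [nsmul_eq_mul, Finset.card_univ, Fintype.card_fun, Fintype.card_fin, Fintype.card_fin]
  push_cast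
  ring

/-! ### Asymptotics -/

theorem risk_le_two (θ β₀ s A : ℝ) (T : Test n) : risk θ β₀ s A T ≤ 2 := by
  have := risk_le (s := s) (A := A) zero_le_one (prob_le_one θ (fun _ => β₀) {Y | T Y = 1})
    fun β _ => prob_le_one θ β {Y | T Y = 0}
  linarith

theorem allTestsAsympPowerless_of_le {θ β₀ : ℝ} {s A ε : ℕ → ℝ} (hε : Tendsto ε atTop (𝓝 0))
    (h : ∀ᶠ n in atTop, ∀ T : Test n, 1 - ε n ≤ risk θ β₀ (s n) (A n) T) :
    AllTestsAsympPowerless θ β₀ s A := by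
  have hb1 : ∀ T : ∀ n, Test n, IsBoundedUnder (· ≤ ·) atTop
      fun n => risk θ β₀ (s n) (A n) (T n) := fun T =>
    isBoundedUnder_of ⟨2, fun n => risk_le_two _ _ _ _ _⟩
  have hb2 : ∀ T : ∀ n, Test n, IsBoundedUnder (· ≥ ·) atTop
      fun n => risk θ β₀ (s n) (A n) (T n) := fun T =>
    isBoundedUnder_of ⟨0, fun n => risk_nonneg _ _ _ _ _⟩
  have hlim : Tendsto (fun n => 1 - ε n) atTop (𝓝 1) := by simpa using hε.const_sub 1
  have h1 : ∀ T : ∀ n, Test n,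
      1 ≤ liminf (fun n => risk θ β₀ (s n) (A n) (T n)) atTop := by
    intro T
    rw [← hlim.liminf_eq]
    exact liminf_le_liminf (h.mono fun n hn => hn (T n)) hlim.isBoundedUnder_ge
      (hb1 T).isCoboundedUnder_ge
  exact ⟨h1, fun T hT => tendsto_of_le_liminf_of_limsup_le (h1 T) hT (hb1 T) (hb2 T)⟩

/-- One statement covers both powerless regimes: `t ≤ -1/2` gives `n * A ^ 2 ≤ 1`, and `b + t < 0`
gives `s * A → 0`. -/
theorem allTestsAsympPowerless {θ β₀ : ℝ} (hΘ : (θ, β₀) ∈ Theta1) {b t : ℝ} (hb : 0 < b)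
    (hb1 : b < 1) (ht : t + 1 / 2 ≤ 0) (hbt : b + t < 0) :
    AllTestsAsympPowerless θ β₀ (fun n => (n : ℝ) ^ b) (fun n => (n : ℝ) ^ t) := by
  obtain ⟨K, hK0, δ, hδ, hK⟩ := exists_gcov_wdeg_le hΘ
  set K' := K / 4 + K / 2 * Real.exp (K / 4) with hK'
  have hlim : Tendsto (fun n : ℕ => Real.sqrt (Real.exp (K' * (2 * (n : ℝ) ^ (b + t)) ^ 2) - 1))
      atTop (𝓝 0) := by
    have h1 := (((tendsto_natCast_rpow_neg hbt).const_mul 2).pow 2).const_mul K'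
    have h2 := ((Real.continuous_exp.tendsto _).comp h1).sub_const 1
    have h3 := (Real.continuous_sqrt.tendsto _).comp h2
    simpa [Function.comp_def] using h3
  refine allTestsAsympPowerless_of_le hlim ?_
  filter_upwards [eventually_ge_atTop 2, (tendsto_natCast_rpow_neg
    (by linarith : t < 0)).eventually_le_const (half_pos hδ)] with n hn hAδ T
  have hn2 : (2 : ℝ) ≤ n := by exact_mod_cast hn
  have hn0 : (0 : ℝ) < n := by linarith
  have hpb : 1 ≤ (n : ℝ) ^ b := Real.one_le_rpow (by linarith) hb.le
  have hpt := Real.rpow_pos_of_pos hn0 t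
  set s := ⌈(n : ℝ) ^ b⌉₊ with hs
  have hs1 : (n : ℝ) ^ b ≤ s := Nat.le_ceil _
  have hs2 : (s : ℝ) ≤ 2 * (n : ℝ) ^ b := by
    have := (Nat.ceil_lt_add_one (by linarith : 0 ≤ (n : ℝ) ^ b)).le
    linarith
  have hspos : (0 : ℝ) < s := by linarith
  have hsn : s ≤ n := by
    refine Nat.ceil_le.2 ?_
    calc (n : ℝ) ^ b ≤ (n : ℝ) ^ (1 : ℝ) := Real.rpow_le_rpow_of_exponent_le (by linarith) hb1.le
      _ = n := Real.rpow_one _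
  have hspos' : 0 < s := by exact_mod_cast hspos
  -- Blocks of size `n / s` rounded down: the rounding loses at most a factor `2`, as `n < s * (m +
  -- 1)` and `m ≥ 1`.
  set m := n / s with hm
  have hm1 : 1 ≤ m := (Nat.one_le_div_iff hspos').2 hsn
  have hsm : s * m ≤ n := Nat.mul_div_le n s
  have hnsm : (n : ℝ) ≤ 2 * (s * m) := by
    have h1 : n < s * (m + 1) := by
      rw [mul_comm]
      exact Nat.lt_mul_of_div_lt (Nat.lt_succ_self _) hspos'
    have h2 : n ≤ 2 * (s * m) := by nlinarith
    exact_mod_cast h2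
  have hm0 : (0 : ℝ) < m := by exact_mod_cast hm1
  refine le_trans ?_ (one_sub_sqrt_exp_le_risk
    (finProdFinEquiv.toEmbedding.trans (Fin.castLEEmb hsm)) hK0 hpt (by linarith) hs1 hm1
    (hK n hn) T)
  gcongr
  have hsA : (s : ℝ) * (n : ℝ) ^ t ≤ 2 * (n : ℝ) ^ (b + t) := by
    rw [Real.rpow_add hn0, ← mul_assoc]
    gcongr
  have hnA : (n : ℝ) * ((n : ℝ) ^ t) ^ 2 ≤ 1 := by
    have : (n : ℝ) ^ (1 + 2 * t) = n * ((n : ℝ) ^ t) ^ 2 := by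
      rw [Real.rpow_add hn0, Real.rpow_one, mul_comm 2 t, Real.rpow_mul hn0.le, Real.rpow_two]
    rw [← this]
    exact Real.rpow_le_one_of_one_le_of_nonpos (by linarith) (by linarith)
  set A := (n : ℝ) ^ t with hA
  set x := K / 4 * (n * A ^ 2) with hx
  have hx0 : 0 ≤ x := by positivity
  have hx1 : x ≤ K / 4 := mul_le_of_le_one_right (by positivity) hnA
  have hexp : Real.exp x - 1 ≤ x * Real.exp (K / 4) := by
    have h1 := abs_one_sub_exp_le x
    rw [abs_of_nonneg hx0, abs_sub_comm] at h1
    refine (le_abs_self _).trans (h1.trans ?_)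
    gcongr
  -- As `x` is bounded, `exp x - 1` is of order `n * A ^ 2`. Trading `n / m` for `2 * s` makes the
  -- overlap term comparable with `(s * A) ^ 2`.
  have h1 : (s : ℝ) * (Real.exp x - 1) / m ≤ K / 2 * Real.exp (K / 4) * (s * A) ^ 2 := by
    rw [div_le_iff₀ hm0]
    calc (s : ℝ) * (Real.exp x - 1) ≤ s * (x * Real.exp (K / 4)) := by gcongr
      _ = K / 4 * Real.exp (K / 4) * s * A ^ 2 * n := by rw [hx]; ring
      _ ≤ K / 4 * Real.exp (K / 4) * s * A ^ 2 * (2 * (s * m)) := by gcongr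
      _ = _ := by ring
  calc K / 4 * (s * A) ^ 2 + s * (Real.exp x - 1) / m ≤ K' * (s * A) ^ 2 := by
        rw [hK']; linarith
    _ ≤ K' * (2 * (n : ℝ) ^ (b + t)) ^ 2 := by gcongr

end LowerBound

end TwoStar

end

open TwoStar in
theorem theorem3 (θ β₀ : ℝ) (hΘ : (θ, β₀) ∈ Theta1) :
    ∃ C : ℝ, 0 < C ∧ ∀ b t : ℝ, 0 < b → b < 1 → t < 0 →
      -- (a)
      (1 / 2 ≤ b → b + t < 0 →
        AllTestsAsympPowerless θ β₀ (fun n => (n : ℝ) ^ b) (fun n => (n : ℝ) ^ t)) ∧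
      -- (b)
      (1 / 2 ≤ b → 0 < b + t → ∀ L : ℕ → ℝ,
        Tendsto (fun n : ℕ => L n / (n : ℝ)) atTop atTop →
        Tendsto (fun n : ℕ => L n / ((n : ℝ) * (n : ℝ) ^ b * (n : ℝ) ^ t)) atTop (𝓝 0) →
        AsympPowerful θ β₀ (fun n => (n : ℝ) ^ b) (fun n => (n : ℝ) ^ t)
          (fun n => sumTest n θ β₀ (L n))) ∧
      -- (c)
      (b < 1 / 2 → t + 1 / 2 ≤ 0 →
        AllTestsAsympPowerless θ β₀ (fun n => (n : ℝ) ^ b) (fun n => (n : ℝ) ^ t)) ∧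
      -- (d)
      (b < 1 / 2 → 0 < t + 1 / 2 →
        AsympPowerful θ β₀ (fun n => (n : ℝ) ^ b) (fun n => (n : ℝ) ^ t)
          (fun n => maxTest n θ β₀ (C * Real.sqrt ((n : ℝ) * Real.log n)))) := by
  have hθ : 0 ≤ θ := by
    rcases hΘ with ⟨⟨h, _⟩, _⟩ | ⟨h, _⟩ <;> exact le_of_lt h
  have hp : 0 ≤ proxy θ := by unfold proxy; positivity
  -- In (a), `b ≥ 1/2` and `b + t < 0` force `t < -1/2`; in (c), `b < 1/2` and `t ≤ -1/2` force `b +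
  -- t < 0`. Both reduce to `allTestsAsympPowerless`.
  refine ⟨proxy θ / 2 + 2, by positivity, fun b t hb hb1 ht =>
    ⟨fun h1 h2 => allTestsAsympPowerless hΘ hb hb1 (by linarith) h2,
      fun _ h2 L hL hL' => asympPowerful_sumTest hθ β₀ ht h2 hL hL',
      fun h1 h2 => allTestsAsympPowerless hΘ hb hb1 h2 (by linarith),
      fun _ h2 => asympPowerful_maxTest hθ β₀ ht h2⟩⟩
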